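/- Let $?:[0,1]\to[0,1]$ be the Minkowski question mark function, i.e. the continuous function with $?(0)=0$, $?(1)=1$ and $?\left(\frac{p+p'}{q+q'}\right)=\frac12\left(?\left(\frac pq\right)+?\left(\frac{p'}{q'}\right)\right)$ for all consecutive fractions $\frac pq,\frac{p'}{q'}$ in each of the Stern–Brocot sequences of $[0,1]$ (start with $\frac01,\frac11$ and repeatedly insert all mediants of neighbours). For an irrational $x=[0;a_1,a_2,\dots]\in(0,1)$ and $t\in\mathbb N$ put $S_x(t)=a_1+\dots+a_t$, and let $\lambda_1=\frac{1+\sqrt5}{2}$, $\kappa_1=\frac{2\log\lambda_1}{\log 2}$. (i) Let $x\in(0,1)$ be irrational and suppose that the derivative $?'(x)$ exists and $?'(x)=0$. Then for every real function $\psi=\psi(t)$, $t\in\mathbb N$, with $\psi(t)\ge 0$ and $\psi(t)=o\left(\frac{\log\log t}{\log t}\right)$ as $t\to\infty$, there is $T$ (depending on $x$ and $\psi$) such that for all integers $t\ge T$ $$\max_{1\le u\le t}\left(S_x(u)-\kappa_1u\right)\ \ge\ \frac{\sqrt{2\log\lambda_1-\log2}}{\log2}\cdot\sqrt{t\log t}\cdot\left(1-t^{-\psi(t)}\right),$$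 where $u$ runs over integers. (ii) There exists an irrational $x\in(0,1)$ such that $?'(x)$ exists, $?'(x)=0$, and for all sufficiently large integers $t$ $$S_x(t)-\kappa_1t\ \le\ \frac{\sqrt{16\log\lambda_1-8\log2}}{\log2}\cdot\sqrt{t\log t}\cdot\left(1+2^5\,\frac{\log\log t}{\log t}\right).$$ -/

import Mathlib

/-- Numerator of the `j`-th element (`0 ≤ j ≤ 2 ^ n`) of the `n`-th Stern-Brocot sequence `F_n`:
`F_0 = {0/1, 1/1}`, and `F_(n+1)` arises from `F_n` by inserting the mediant
`(p + p') / (q + q')` between any two consecutive fractions `p / q` and `p' / q'`. -/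
def sternBrocotNum : ℕ → ℕ → ℕ
  | 0, j => j
  | n + 1, j =>
      if j % 2 = 0 then sternBrocotNum n (j / 2)
      else sternBrocotNum n (j / 2) + sternBrocotNum n (j / 2 + 1)

/-- Denominator of the `j`-th element (`0 ≤ j ≤ 2 ^ n`) of the `n`-th Stern-Brocot sequence. -/
def sternBrocotDen : ℕ → ℕ → ℕ
  | 0, _ => 1
  | n + 1, j =>
      if j % 2 = 0 then sternBrocotDen n (j / 2)
      else sternBrocotDen n (j / 2) + sternBrocotDen n (j / 2 + 1)

/-- The Minkowski question mark function. Its rule `?(0) = 0`, `?(1) = 1`,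
`?(mediant of ξ, ξ') = (?(ξ) + ?(ξ')) / 2` says that it takes the value `j / 2 ^ n` at the `j`-th
element of `F_n`; the extension to irrational arguments by continuity (and monotonicity) is the
supremum of the values at the Stern-Brocot fractions not exceeding `x`.
(Outside `[0, 1]` it is `0` on the left and `1` on the right.) -/
noncomputable def minkowskiQuestionMark (x : ℝ) : ℝ :=
  sSup {y : ℝ | ∃ n j : ℕ, j ≤ 2 ^ n ∧
    (sternBrocotNum n j : ℝ) / (sternBrocotDen n j : ℝ) ≤ x ∧ y = (j : ℝ) / 2 ^ n}

/-- The partial quotient `a_(i+1)` of the regular continued fraction of `x`, as a real number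
(the default value is never used for irrational `x`, whose continued fraction is infinite). -/
noncomputable def partialQuotient (x : ℝ) (i : ℕ) : ℝ :=
  ((GenContFract.of x).partDens.get? i).getD 0

/-- `S_x(t) = a_1 + ... + a_t`. -/
noncomputable def partialQuotientSum (x : ℝ) (t : ℕ) : ℝ :=
  ∑ i ∈ Finset.range t, partialQuotient x i

/-- `λ₁ = (1 + √5) / 2`. -/
noncomputable def lambdaOne : ℝ := (1 + Real.sqrt 5) / 2

/-- `κ₁ = 2 log λ₁ / log 2`. -/
noncomputable def kappaOne : ℝ := 2 * Real.log lambdaOne / Real.log 2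

/-! Write q_t for `cfDen a (t + 1)`, S_t for the sum of the first t digits, λ and κ for `lambdaOne`
and `kappaOne`. Neighbours p/q, p'/q' at Stern–Brocot depth N are 1/(qq') apart, while ? grows by
2^(-N) between them. The convergent p_t/q_t is an endpoint of an interval of depth S_t around x, so
the slope there has order q_t^2 / 2^(S_t). Vanishing derivative forces q_t^2 ≤ 2^(S_t) eventually
(`eventually_sq_cfDen_le`); conversely, q_t^2 / 2^(S_t) → 0 gives derivative 0 at irrational x
(`hasDerivAt_zero`).

Up to a constant factor, q_t lies between λ^t ∏(1 + (a_i - 1)/λ^2) and λ^t ∏(1 + (a_i - 1)/λ).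
Taking logarithms turns the slope conditions into statements about the excess S_t - κt: large digits
raise the excess, but each one costs about (2/log 2) log a_i.

(i) If the excess is at most M up to time t, every digit is at most about M. Since the digits sum to
about κt at least, concavity of log makes the total cost smallest when the sum of the a_i - 1 is
concentrated in digits of size M. Cost ≤ excess then gives M^2 ≥ (2/log 2)(κ - 1) t log M up to
bounded corrections, and log M is about (log t)/2 (`excess_bound_sq_ge`, `eventually_ge_of_sq_ge`).

(ii) Take all digits 1 except jumps of size about σ k log k, with σ = 2/log 2. The k-th jump is
placed when the drift κ - 1 per step has used up the previous jumps minus their costs and one unit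
each. The units make q_t^2 / 2^(S_t) tend to 0. At a peak the excess is about the last jump plus the
accumulated costs, 2σ k log k, while t is about σ k^2 log k / (2(κ - 1)). -/

/-! ### Stern–Brocot sequences and the values of ? on them -/

theorem sternBrocotNum_even (n j : ℕ) :
    sternBrocotNum (n + 1) (2 * j) = sternBrocotNum n j := by
  simp [sternBrocotNum]

theorem sternBrocotDen_even (n j : ℕ) :
    sternBrocotDen (n + 1) (2 * j) = sternBrocotDen n j := by
  simp [sternBrocotDen]

theorem sternBrocotNum_odd (n j : ℕ) :
    sternBrocotNum (n + 1) (2 * j + 1) = sternBrocotNum n j + sternBrocotNum n (j + 1) := by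
  have h1 : (2 * j + 1) % 2 ≠ 0 := by omega
  have h2 : (2 * j + 1) / 2 = j := by omega
  simp only [sternBrocotNum, if_neg h1, h2]

theorem sternBrocotDen_odd (n j : ℕ) :
    sternBrocotDen (n + 1) (2 * j + 1) = sternBrocotDen n j + sternBrocotDen n (j + 1) := by
  have h1 : (2 * j + 1) % 2 ≠ 0 := by omega
  have h2 : (2 * j + 1) / 2 = j := by omega
  simp only [sternBrocotDen, if_neg h1, h2]

theorem sternBrocotDen_pos (n j : ℕ) : 0 < sternBrocotDen n j := by
  induction n generalizing j with
  | zero => simp [sternBrocotDen]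
  | succ n ih =>
    obtain ⟨i, rfl | rfl⟩ := j.even_or_odd'
    · rw [sternBrocotDen_even]; exact ih i
    · rw [sternBrocotDen_odd]; exact Nat.add_pos_left (ih i) _

theorem sternBrocot_det (n j : ℕ) :
    sternBrocotNum n (j + 1) * sternBrocotDen n j =
      sternBrocotNum n j * sternBrocotDen n (j + 1) + 1 := by
  induction n generalizing j with
  | zero => simp [sternBrocotDen, sternBrocotNum]
  | succ n ih =>
    obtain ⟨i, rfl | rfl⟩ := j.even_or_odd'
    · rw [sternBrocotDen_even, sternBrocotDen_odd, sternBrocotNum_even, sternBrocotNum_odd]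
      have := ih i
      linarith
    · rw [show 2 * i + 1 + 1 = 2 * (i + 1) by ring, sternBrocotDen_even, sternBrocotDen_odd,
        sternBrocotNum_even, sternBrocotNum_odd]
      have := ih i
      linarith

/-- The `j`-th element of the `n`-th Stern-Brocot sequence, as a real number. -/
noncomputable def sternBrocot (n j : ℕ) : ℝ :=
  (sternBrocotNum n j : ℝ) / (sternBrocotDen n j : ℝ)

theorem sternBrocot_succ_sub (n j : ℕ) :
    sternBrocot n (j + 1) - sternBrocot n j =
      1 / ((sternBrocotDen n j : ℝ) * sternBrocotDen n (j + 1)) := by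
  have h1 : (0 : ℝ) < sternBrocotDen n j := by exact_mod_cast sternBrocotDen_pos n j
  have h2 : (0 : ℝ) < sternBrocotDen n (j + 1) := by exact_mod_cast sternBrocotDen_pos n (j + 1)
  have h3 : (sternBrocotNum n (j + 1) : ℝ) * sternBrocotDen n j =
      sternBrocotNum n j * sternBrocotDen n (j + 1) + 1 := by
    exact_mod_cast sternBrocot_det n j
  unfold sternBrocot
  field_simp
  linarith

theorem sternBrocot_strictMono (n : ℕ) : StrictMono (sternBrocot n) := by
  refine strictMono_nat_of_lt_succ fun j => ?_
  have h1 : (0 : ℝ) < sternBrocotDen n j := by exact_mod_cast sternBrocotDen_pos n j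
  have h2 : (0 : ℝ) < sternBrocotDen n (j + 1) := by exact_mod_cast sternBrocotDen_pos n (j + 1)
  rw [← sub_pos, sternBrocot_succ_sub]
  positivity

theorem sternBrocot_refine (n m j : ℕ) : sternBrocot (n + m) (2 ^ m * j) = sternBrocot n j := by
  induction m with
  | zero => simp
  | succ m ih =>
    rw [← ih, ← add_assoc, pow_succ', mul_assoc]
    simp only [sternBrocot, sternBrocotNum_even, sternBrocotDen_even]

/-- Both fractions reappear at depth n + m, where strict monotonicity reduces the comparison to
indices. This makes ? well defined across depths. -/
theorem sternBrocot_le_iff (n m i j : ℕ) :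
    sternBrocot n j ≤ sternBrocot m i ↔ (j : ℝ) / 2 ^ n ≤ (i : ℝ) / 2 ^ m := by
  rw [← sternBrocot_refine n m j, ← sternBrocot_refine m n i, add_comm m n,
    (sternBrocot_strictMono _).le_iff_le, div_le_div_iff₀ (by positivity) (by positivity)]
  rw [mul_comm, mul_comm (2 ^ n) i]
  exact_mod_cast Iff.rfl

theorem minkowskiQuestionMark_sternBrocot {n j : ℕ} (hj : j ≤ 2 ^ n) :
    minkowskiQuestionMark (sternBrocot n j) = (j : ℝ) / 2 ^ n := by
  refine IsGreatest.csSup_eq ⟨⟨n, j, hj, le_rfl, rfl⟩, ?_⟩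
  rintro y ⟨m, i, -, h, rfl⟩
  exact (sternBrocot_le_iff m n j i).1 h

theorem minkowskiQuestionMark_monotoneOn : MonotoneOn minkowskiQuestionMark (Set.Ici 0) := by
  intro x hx y _ hxy
  refine csSup_le_csSup ⟨1, ?_⟩ ⟨0, 0, 0, by simp, by simpa [sternBrocotNum] using hx, by simp⟩ ?_
  · rintro z ⟨n, j, hj, -, rfl⟩
    rw [div_le_one (by positivity)]
    exact_mod_cast hj
  · rintro z ⟨n, j, hj, h, rfl⟩
    exact ⟨n, j, hj, h.trans hxy, rfl⟩

/-! ### Stern–Brocot intervals and slope bounds -/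

/-- `p / q` and `p' / q'` are neighbours, in either order, in the `N`-th Stern-Brocot sequence. -/
def SternBrocotAdj (N p q p' q' : ℕ) : Prop :=
  ∃ j < 2 ^ N,
    (sternBrocotNum N j = p ∧ sternBrocotDen N j = q ∧
      sternBrocotNum N (j + 1) = p' ∧ sternBrocotDen N (j + 1) = q') ∨
    (sternBrocotNum N j = p' ∧ sternBrocotDen N j = q' ∧
      sternBrocotNum N (j + 1) = p ∧ sternBrocotDen N (j + 1) = q)

namespace SternBrocotAdj

variable {N p q p' q' : ℕ}

theorem symm (h : SternBrocotAdj N p q p' q') : SternBrocotAdj N p' q' p q := by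
  obtain ⟨j, hj, h⟩ := h
  exact ⟨j, hj, h.symm⟩

theorem zero_one : SternBrocotAdj 0 0 1 1 1 :=
  ⟨0, by simp, Or.inl (by simp [sternBrocotNum, sternBrocotDen])⟩

theorem mediant (h : SternBrocotAdj N p q p' q') :
    SternBrocotAdj (N + 1) p q (p + p') (q + q') := by
  obtain ⟨j, hj, ⟨rfl, rfl, rfl, rfl⟩ | ⟨rfl, rfl, rfl, rfl⟩⟩ := h
  · exact ⟨2 * j, by rw [pow_succ']; omega, Or.inl ⟨sternBrocotNum_even _ _,
      sternBrocotDen_even _ _, sternBrocotNum_odd _ _, sternBrocotDen_odd _ _⟩⟩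
  · refine ⟨2 * j + 1, by rw [pow_succ']; omega, Or.inr ⟨?_, ?_, ?_, ?_⟩⟩
    · rw [sternBrocotNum_odd, add_comm]
    · rw [sternBrocotDen_odd, add_comm]
    · exact sternBrocotNum_even N (j + 1)
    · exact sternBrocotDen_even N (j + 1)

theorem den_pos (h : SternBrocotAdj N p q p' q') : 0 < q := by
  obtain ⟨j, -, ⟨-, rfl, -, -⟩ | ⟨-, -, -, rfl⟩⟩ := h <;> exact sternBrocotDen_pos _ _

theorem abs_sub_eq (h : SternBrocotAdj N p q p' q') :
    |(p : ℝ) / q - (p' : ℝ) / q'| = 1 / ((q : ℝ) * q') := by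
  obtain ⟨j, -, ⟨rfl, rfl, rfl, rfl⟩ | ⟨rfl, rfl, rfl, rfl⟩⟩ := h
  · have := sternBrocot_succ_sub N j
    unfold sternBrocot at this
    rw [abs_sub_comm, this, abs_of_nonneg (by positivity)]
  · have := sternBrocot_succ_sub N j
    unfold sternBrocot at this
    rw [this, abs_of_nonneg (by positivity), mul_comm]

theorem abs_questionMark_sub_eq (h : SternBrocotAdj N p q p' q') :
    |minkowskiQuestionMark ((p : ℝ) / q) - minkowskiQuestionMark ((p' : ℝ) / q')| =
      1 / 2 ^ N := by
  have key (j : ℕ) (hj : j < 2 ^ N) : minkowskiQuestionMark (sternBrocot N (j + 1)) -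
      minkowskiQuestionMark (sternBrocot N j) = 1 / 2 ^ N := by
    rw [minkowskiQuestionMark_sternBrocot hj.le, minkowskiQuestionMark_sternBrocot hj]
    push_cast; ring
  obtain ⟨j, hj, ⟨rfl, rfl, rfl, rfl⟩ | ⟨rfl, rfl, rfl, rfl⟩⟩ := h
  · have := key j hj
    unfold sternBrocot at this
    rw [abs_sub_comm, this, abs_of_nonneg (by positivity)]
  · have := key j hj
    unfold sternBrocot at this
    rw [this, abs_of_nonneg (by positivity)]

theorem abs_questionMark_sub_le (h : SternBrocotAdj N p q p' q') {z : ℝ}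
    (hz : z ∈ Set.uIcc ((p : ℝ) / q) ((p' : ℝ) / q')) :
    |minkowskiQuestionMark z - minkowskiQuestionMark ((p' : ℝ) / q')| ≤ 1 / 2 ^ N := by
  rw [← h.abs_questionMark_sub_eq]
  have h1 : (0 : ℝ) ≤ (p : ℝ) / q := by positivity
  have h2 : (0 : ℝ) ≤ (p' : ℝ) / q' := by positivity
  have m := minkowskiQuestionMark_monotoneOn
  rcases Set.mem_uIcc.1 hz with ⟨ha, hb⟩ | ⟨ha, hb⟩
  · have := m h1 (h1.trans ha) ha
    have := m (h1.trans ha) h2 hb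
    rw [abs_sub_comm, abs_of_nonneg (by linarith), abs_sub_comm, abs_of_nonneg (by linarith)]
    linarith
  · have := m h2 (h2.trans ha) ha
    have := m (h2.trans ha) h1 hb
    rw [abs_of_nonneg (by linarith), abs_of_nonneg (by linarith)]
    linarith

end SternBrocotAdj

/-- A generalized mediant with nonnegative weight lies between the two fractions. -/
theorem mem_uIcc_of_weighted_mediant {p q p' q' s x : ℝ} (hq : 0 < q) (hq' : 0 < q') (hs : 0 ≤ s)
    (hx : x * (q' + s * q) = p' + s * p) : x ∈ Set.uIcc (p / q) (p' / q') := by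
  have h1 : q * (x - p / q) = q * x - p := by field_simp
  have h2 : q' * (x - p' / q') = q' * x - p' := by field_simp
  rcases le_total (q * x) p with h | h
  · refine Set.mem_uIcc.2 (Or.inr ⟨?_, ?_⟩)
    · rw [div_le_iff₀ hq']; nlinarith
    · rw [le_div_iff₀ hq]; linarith
  · refine Set.mem_uIcc.2 (Or.inl ⟨?_, ?_⟩)
    · rw [div_le_iff₀ hq]; linarith
    · rw [le_div_iff₀ hq']; nlinarith

theorem abs_sub_add_abs_sub_of_mem_uIcc {a b m : ℝ} (h : m ∈ Set.uIcc a b) :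
    |a - m| + |m - b| = |a - b| := by
  rcases Set.mem_uIcc.1 h with ⟨h1, h2⟩ | ⟨h1, h2⟩
  · rw [abs_of_nonpos (by linarith), abs_of_nonpos (by linarith), abs_of_nonpos (by linarith)]
    ring
  · rw [abs_of_nonneg (by linarith), abs_of_nonneg (by linarith), abs_of_nonneg (by linarith)]
    ring

namespace SternBrocotAdj

variable {N p q p' q' : ℕ}

theorem mediant_mem (h : SternBrocotAdj N p q p' q') :
    ((p + p' : ℕ) : ℝ) / ((q + q' : ℕ) : ℝ) ∈ Set.uIcc ((p : ℝ) / q) ((p' : ℝ) / q') := by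
  have h1 : (0 : ℝ) < q := by exact_mod_cast h.den_pos
  have h2 : (0 : ℝ) < q' := by exact_mod_cast h.symm.den_pos
  refine mem_uIcc_of_weighted_mediant h1 h2 zero_le_one ?_
  push_cast
  field_simp
  ring

/-- One-sided slope bound at an endpoint of a Stern-Brocot interval. -/
theorem slope_le (h : SternBrocotAdj N p q p' q') {z : ℝ}
    (hz : z ∈ Set.uIcc ((p : ℝ) / q) ((p' : ℝ) / q')) :
    |minkowskiQuestionMark z - minkowskiQuestionMark ((p' : ℝ) / q')| ≤
      (q' : ℝ) * (q + q') / 2 ^ N * |z - (p' : ℝ) / q'| := by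
  rcases eq_or_ne z ((p' : ℝ) / q') with rfl | hne
  · simp
  have hpos : 0 < |z - (p' : ℝ) / q'| := abs_pos.2 (sub_ne_zero.2 hne)
  -- Termination measure: each passage to the half adjacent to p'/q' raises q by q' ≥ 1, so the
  -- index k in 1/(q + k) can drop by one.
  obtain ⟨n, hn⟩ := exists_nat_one_div_lt hpos
  have hn' : 1 / ((q : ℝ) + (n + 1 : ℕ)) < |z - (p' : ℝ) / q'| := by
    refine lt_of_le_of_lt ?_ hn
    have : (0 : ℝ) ≤ q := by positivity
    push_cast
    exact one_div_le_one_div_of_le (by positivity) (by linarith)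
  generalize n + 1 = k at hn'
  clear hn
  induction k generalizing N p q with
  | zero =>
    exfalso
    have h1 : (1 : ℝ) ≤ q := by exact_mod_cast h.den_pos
    have h2 : (1 : ℝ) ≤ q' := by exact_mod_cast h.symm.den_pos
    have h3 : |z - (p' : ℝ) / q'| ≤ |(p : ℝ) / q - (p' : ℝ) / q'| := by
      rw [← abs_sub_add_abs_sub_of_mem_uIcc hz]
      linarith [abs_nonneg ((p : ℝ) / q - z)]
    rw [h.abs_sub_eq] at h3
    have h4 : 1 / ((q : ℝ) * q') ≤ 1 / ((q : ℝ) + (0 : ℕ)) := by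
      rw [Nat.cast_zero, add_zero]
      exact one_div_le_one_div_of_le (by linarith) (by nlinarith)
    linarith
  | succ k ih =>
    have h1 : (1 : ℝ) ≤ q := by exact_mod_cast h.den_pos
    have h2 : (1 : ℝ) ≤ q' := by exact_mod_cast h.symm.den_pos
    have hm := h.symm.mediant.symm
    rcases Set.uIcc_subset_uIcc_union_uIcc
      (b := ((p' + p : ℕ) : ℝ) / ((q' + q : ℕ) : ℝ)) hz with hz' | hz'
    -- z lies beyond the mediant, hence at distance at least 1/(q'(q + q')) from p'/q', while ?
    -- varies by at most 2^(-N).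
    · have h3 := h.abs_questionMark_sub_le hz
      have h4 : 1 / ((q' : ℝ) * (q + q')) ≤ |z - (p' : ℝ) / q'| := by
        have h5 := hm.abs_sub_eq
        have h6 : ((p' + p : ℕ) : ℝ) / ((q' + q : ℕ) : ℝ) ∈ Set.uIcc z ((p' : ℝ) / q') := by
          have h7 := h.symm.mediant_mem
          rw [Set.mem_uIcc] at h7 hz' ⊢
          rcases hz' with hz' | hz' <;> rcases h7 with h7 | h7
          · exact Or.inr ⟨by linarith, by linarith⟩
          · exact Or.inl ⟨by linarith, by linarith⟩
          · exact Or.inr ⟨by linarith, by linarith⟩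
          · exact Or.inl ⟨by linarith, by linarith⟩
        rw [← abs_sub_add_abs_sub_of_mem_uIcc h6, h5]
        push_cast
        rw [mul_comm (q' : ℝ), add_comm (q : ℝ)]
        linarith [abs_nonneg (z - ((p' : ℝ) + p) / ((q' : ℝ) + q))]
      calc _ ≤ 1 / 2 ^ N := h3
        _ = (q' : ℝ) * (q + q') / 2 ^ N * (1 / ((q' : ℝ) * (q + q'))) := by field_simp
        _ ≤ _ := by gcongr
    · have hlt : 1 / (((q' + q : ℕ) : ℝ) + (k : ℝ)) < |z - (p' : ℝ) / q'| := by
        refine lt_of_le_of_lt ?_ hn'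
        push_cast
        apply one_div_le_one_div_of_le <;> linarith
      -- Halving the increment of ? outweighs the growth of the denominator: q + 2q' ≤ 2(q + q').
      refine (ih hm hz' hlt).trans ?_
      refine mul_le_mul_of_nonneg_right ?_ (abs_nonneg _)
      rw [pow_succ, div_le_div_iff₀ (by positivity) (by positivity)]
      push_cast
      have : (0 : ℝ) < 2 ^ N := by positivity
      have h8 : (q' : ℝ) * (q' + q + q') ≤ q' * (q + q') * 2 := by nlinarith
      nlinarith

end SternBrocotAdj

theorem sternBrocotDen_add_ge (N j : ℕ) :
    N + 2 ≤ sternBrocotDen N j + sternBrocotDen N (j + 1) := by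
  induction N generalizing j with
  | zero => simp [sternBrocotDen]
  | succ N ih =>
    obtain ⟨i, rfl | rfl⟩ := j.even_or_odd'
    · rw [sternBrocotDen_even, sternBrocotDen_odd]
      have := ih i
      have := sternBrocotDen_pos N i
      omega
    · rw [show 2 * i + 1 + 1 = 2 * (i + 1) by ring, sternBrocotDen_even, sternBrocotDen_odd]
      have := ih i
      have := sternBrocotDen_pos N (i + 1)
      omega

namespace SternBrocotAdj

variable {N p q p' q' : ℕ}

/-- Positive integers with q + q' ≥ N + 2 have qq' ≥ N + 1. -/
theorem width_le (h : SternBrocotAdj N p q p' q') :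
    |(p : ℝ) / q - (p' : ℝ) / q'| ≤ 1 / ((N : ℝ) + 1) := by
  have h0 : N + 2 ≤ q + q' := by
    obtain ⟨j, -, ⟨-, rfl, -, rfl⟩ | ⟨-, rfl, -, rfl⟩⟩ := h
    · exact sternBrocotDen_add_ge N j
    · have := sternBrocotDen_add_ge N j
      omega
  have h1 : (1 : ℝ) ≤ q := by exact_mod_cast h.den_pos
  have h2 : (1 : ℝ) ≤ q' := by exact_mod_cast h.symm.den_pos
  have h3 : (N : ℝ) + 2 ≤ q + q' := by exact_mod_cast h0
  rw [h.abs_sub_eq]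
  exact one_div_le_one_div_of_le (by positivity) (by nlinarith)

/-- Slope bound for two points separated by the mediant of a Stern-Brocot interval. -/
theorem slope_le_of_separated (h : SternBrocotAdj N p q p' q') {x y : ℝ}
    (hx : x ∈ Set.uIcc ((p : ℝ) / q) (((p + p' : ℕ) : ℝ) / ((q + q' : ℕ) : ℝ)))
    (hy : y ∈ Set.uIcc (((p + p' : ℕ) : ℝ) / ((q + q' : ℕ) : ℝ)) ((p' : ℝ) / q')) :
    |minkowskiQuestionMark y - minkowskiQuestionMark x| ≤
      ((q : ℝ) + q') ^ 2 / 2 ^ N * |y - x| := by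
  have h1 : (1 : ℝ) ≤ q := by exact_mod_cast h.den_pos
  have h2 : (1 : ℝ) ≤ q' := by exact_mod_cast h.symm.den_pos
  have hm := h.mediant_mem
  have hl := h.mediant
  have hr := h.symm.mediant
  rw [add_comm p', add_comm q'] at hr
  have bx := hl.slope_le hx
  have by' := hr.slope_le (z := y) (by rw [Set.uIcc_comm]; exact hy)
  set m : ℝ := ((p + p' : ℕ) : ℝ) / ((q + q' : ℕ) : ℝ) with hmdef
  have hmm : m ∈ Set.uIcc y x := by
    rw [Set.mem_uIcc] at hx hy hm ⊢
    rcases hx with hx | hx <;> rcases hy with hy | hy <;> rcases hm with hm | hm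
    all_goals first
      | exact Or.inl ⟨by linarith, by linarith⟩
      | exact Or.inr ⟨by linarith, by linarith⟩
  rw [← abs_sub_add_abs_sub_of_mem_uIcc hmm]
  have c1 : ((q + q' : ℕ) : ℝ) * (q + (q + q' : ℕ)) / 2 ^ (N + 1) ≤ ((q : ℝ) + q') ^ 2 / 2 ^ N := by
    rw [pow_succ, div_le_div_iff₀ (by positivity) (by positivity)]
    push_cast
    have : ((q : ℝ) + q') * (q + (q + q')) ≤ (q + q') ^ 2 * 2 := by nlinarith
    have h0 : (0 : ℝ) < 2 ^ N := by positivity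
    nlinarith
  have c2 : ((q + q' : ℕ) : ℝ) * (q' + (q + q' : ℕ)) / 2 ^ (N + 1) ≤
      ((q : ℝ) + q') ^ 2 / 2 ^ N := by
    rw [pow_succ, div_le_div_iff₀ (by positivity) (by positivity)]
    push_cast
    have : ((q : ℝ) + q') * (q' + (q + q')) ≤ (q + q') ^ 2 * 2 := by nlinarith
    have h0 : (0 : ℝ) < 2 ^ N := by positivity
    nlinarith
  have d1 := mul_le_mul_of_nonneg_right c1 (abs_nonneg (x - m))
  have d2 := mul_le_mul_of_nonneg_right c2 (abs_nonneg (y - m))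
  have e := abs_sub_le (minkowskiQuestionMark y) (minkowskiQuestionMark m)
    (minkowskiQuestionMark x)
  rw [abs_sub_comm (minkowskiQuestionMark m)] at e
  rw [mul_add, abs_sub_comm m x]
  linarith

end SternBrocotAdj

/-! ### Continued fractions and the derivative criterion -/

/-- `ξ i = [0; a i, a (i + 1), …]` for all `i`. -/
structure IsCFExpansion (a : ℕ → ℕ) (ξ : ℕ → ℝ) : Prop where
  pos : ∀ i, 0 < ξ i
  lt_one : ∀ i, ξ i < 1
  mul_eq : ∀ i, ξ i * (a i + ξ (i + 1)) = 1

/-- Numerators of the convergents of `[0; a 0, a 1, …]`, starting with `p₋₁ = 1`. -/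
def cfNum (a : ℕ → ℕ) : ℕ → ℕ
  | 0 => 1
  | 1 => 0
  | n + 2 => a n * cfNum a (n + 1) + cfNum a n

/-- Denominators of the convergents of `[0; a 0, a 1, …]`, starting with `q₋₁ = 0`. -/
def cfDen (a : ℕ → ℕ) : ℕ → ℕ
  | 0 => 0
  | 1 => 1
  | n + 2 => a n * cfDen a (n + 1) + cfDen a n

/-- Mediants with p_t/q_t held fixed run through the intermediate fractions. After `a t` of them the
moving endpoint is the next convergent, and the endpoints exchange roles. -/
theorem sternBrocotAdj_convergent {a : ℕ → ℕ} (ha : ∀ i, 1 ≤ a i) (t k : ℕ) :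
    SternBrocotAdj (∑ i ∈ Finset.range t, a i + k) (cfNum a (t + 1)) (cfDen a (t + 1))
      (cfNum a t + (k + 1) * cfNum a (t + 1)) (cfDen a t + (k + 1) * cfDen a (t + 1)) := by
  have step (t : ℕ) (h : SternBrocotAdj (∑ i ∈ Finset.range t, a i) (cfNum a (t + 1))
      (cfDen a (t + 1)) (cfNum a t + cfNum a (t + 1)) (cfDen a t + cfDen a (t + 1))) (k : ℕ) :
      SternBrocotAdj (∑ i ∈ Finset.range t, a i + k) (cfNum a (t + 1)) (cfDen a (t + 1))
      (cfNum a t + (k + 1) * cfNum a (t + 1)) (cfDen a t + (k + 1) * cfDen a (t + 1)) := by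
    induction k with
    | zero => simpa using h
    | succ k ih =>
      convert ih.mediant using 1 <;> ring
  refine step t ?_ k
  clear k
  induction t with
  | zero => simpa [cfNum, cfDen] using SternBrocotAdj.zero_one
  | succ t ih =>
    have h := (step t ih (a t - 1)).symm.mediant
    have e : a t - 1 + 1 = a t := Nat.sub_add_cancel (ha t)
    rw [e] at h
    rw [Finset.sum_range_succ]
    convert h using 1
    · rw [add_assoc, e]
    · simp only [cfNum]; ring
    · simp only [cfDen]; ring
    · simp only [cfNum]; ring
    · simp only [cfDen]; ring

theorem cfDen_succ_pos {a : ℕ → ℕ} (ha : ∀ i, 1 ≤ a i) (t : ℕ) : 0 < cfDen a (t + 1) :=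
  (sternBrocotAdj_convergent ha t 0).den_pos

theorem cfDen_le_succ {a : ℕ → ℕ} (ha : ∀ i, 1 ≤ a i) (t : ℕ) :
    cfDen a t ≤ cfDen a (t + 1) := by
  cases t with
  | zero => simp [cfDen]
  | succ t =>
    simp only [cfDen]
    nlinarith [ha t, cfDen_succ_pos ha t]

namespace IsCFExpansion

variable {a : ℕ → ℕ} {ξ : ℕ → ℝ}

theorem one_le (h : IsCFExpansion a ξ) (i : ℕ) : 1 ≤ a i := by
  by_contra! h0
  have h1 : a i = 0 := by omega
  have h2 := h.mul_eq i
  rw [h1, Nat.cast_zero, zero_add] at h2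
  nlinarith [h.pos i, h.lt_one i, h.pos (i + 1), h.lt_one (i + 1)]

theorem mul_cfDen_eq (h : IsCFExpansion a ξ) (t : ℕ) :
    ξ 0 * (cfDen a (t + 1) + ξ t * cfDen a t) = cfNum a (t + 1) + ξ t * cfNum a t := by
  induction t with
  | zero => simp [cfNum, cfDen]
  | succ t ih =>
    simp only [cfNum, cfDen]
    push_cast
    have h1 := h.mul_eq t
    have h2 := h.pos t
    refine mul_left_cancel₀ h2.ne' ?_
    linear_combination ih + (ξ 0 * cfDen a (t + 1) - cfNum a (t + 1)) * h1

/-- `ξ 0` is the generalized mediant of the endpoints with weight `a t + ξ (t + 1) - (k + 1)`,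
nonnegative because k < `a t`. -/
theorem mem_uIcc (h : IsCFExpansion a ξ) {t k : ℕ} (hk : k < a t) :
    ξ 0 ∈ Set.uIcc ((cfNum a (t + 1) : ℝ) / cfDen a (t + 1))
      (((cfNum a t + (k + 1) * cfNum a (t + 1) : ℕ) : ℝ) /
        ((cfDen a t + (k + 1) * cfDen a (t + 1) : ℕ) : ℝ)) := by
  have hq : (0 : ℝ) < cfDen a (t + 1) := by exact_mod_cast cfDen_succ_pos h.one_le t
  have hk' : (k : ℝ) + 1 ≤ a t := by exact_mod_cast hk
  refine mem_uIcc_of_weighted_mediant (s := a t + ξ (t + 1) - (k + 1)) hq ?_ ?_ ?_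
  · push_cast; positivity
  · linarith [h.pos (t + 1)]
  · push_cast
    have h1 := h.mul_eq t
    have h2 := h.pos t
    refine mul_left_cancel₀ h2.ne' ?_
    linear_combination h.mul_cfDen_eq t + (ξ 0 * cfDen a (t + 1) - cfNum a (t + 1)) * h1

/-- Only slope at most 1 near `ξ 0` is needed. Applied at both endpoints of the interval of depth
S_t, it gives 2^(-S_t) ≤ 1/(q_t(q_(t-1) + q_t)). -/
theorem eventually_sq_cfDen_le (h : IsCFExpansion a ξ)
    (hd : HasDerivAt minkowskiQuestionMark 0 (ξ 0)) :
    ∃ T, ∀ t, T ≤ t → (cfDen a (t + 1) : ℝ) ^ 2 ≤ 2 ^ (∑ i ∈ Finset.range t, a i) := by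
  have hd' := (hasDerivAt_iff_isLittleO.1 hd).bound (c := 1) one_pos
  obtain ⟨δ, hδ, hball⟩ := Metric.eventually_nhds_iff.1 hd'
  obtain ⟨T, hT⟩ := exists_nat_one_div_lt hδ
  refine ⟨T, fun t ht => ?_⟩
  have hadj := sternBrocotAdj_convergent h.one_le t 0
  have hmem := h.mem_uIcc (h.one_le t)
  have hqq : (0 : ℝ) < cfDen a (t + 1) := by exact_mod_cast hadj.den_pos
  have hqq' : (0 : ℝ) < ((cfDen a t + (0 + 1) * cfDen a (t + 1) : ℕ) : ℝ) := by
    exact_mod_cast hadj.symm.den_pos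
  have e1 := hadj.abs_sub_eq
  have e2 := hadj.abs_questionMark_sub_eq
  have e3 := hadj.width_le
  set A : ℝ := (cfNum a (t + 1) : ℝ) / cfDen a (t + 1)
  set B : ℝ := ((cfNum a t + (0 + 1) * cfNum a (t + 1) : ℕ) : ℝ) /
        ((cfDen a t + (0 + 1) * cfDen a (t + 1) : ℕ) : ℝ)
  have e4 := abs_sub_add_abs_sub_of_mem_uIcc hmem
  have hS : t ≤ ∑ i ∈ Finset.range t, a i := by
    simpa using Finset.card_nsmul_le_sum (Finset.range t) a 1 fun i _ => h.one_le i
  have e5 : |A - B| < δ := by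
    refine lt_of_le_of_lt e3 (lt_of_le_of_lt ?_ hT)
    refine one_div_le_one_div_of_le (by positivity) ?_
    have : (T : ℝ) ≤ (∑ i ∈ Finset.range t, a i + 0 : ℕ) := by
      exact_mod_cast ht.trans (by simpa using hS)
    linarith
  have fA := hball (y := A) (by
    rw [Real.dist_eq]; linarith [abs_nonneg (ξ 0 - B)])
  have fB := hball (y := B) (by
    rw [Real.dist_eq, abs_sub_comm]; linarith [abs_nonneg (A - ξ 0)])
  simp only [smul_zero, sub_zero, Real.norm_eq_abs, one_mul] at fA fB
  have f := abs_sub_le (minkowskiQuestionMark A) (minkowskiQuestionMark (ξ 0))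
    (minkowskiQuestionMark B)
  rw [abs_sub_comm (minkowskiQuestionMark (ξ 0))] at f
  rw [abs_sub_comm B] at fB
  have g : 1 / 2 ^ (∑ i ∈ Finset.range t, a i) ≤ 1 /
      ((cfDen a (t + 1) : ℝ) * ((cfDen a t + (0 + 1) * cfDen a (t + 1) : ℕ) : ℝ)) := by
    rw [add_zero] at e2
    rw [← e1, ← e2]
    linarith
  rw [one_div_le_one_div (by positivity) (by positivity)] at g
  refine le_trans ?_ g
  push_cast
  nlinarith [(Nat.cast_nonneg (cfDen a t) : (0 : ℝ) ≤ cfDen a t)]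

theorem sq_cfDen_le (h : IsCFExpansion a ξ)
    (hd : HasDerivAt minkowskiQuestionMark 0 (ξ 0)) :
    ∃ C, 1 ≤ C ∧ ∀ t, (cfDen a (t + 1) : ℝ) ^ 2 ≤ C * 2 ^ (∑ i ∈ Finset.range t, a i) := by
  obtain ⟨T, hT⟩ := h.eventually_sq_cfDen_le hd
  have hnn : 0 ≤ ∑ t ∈ Finset.range T, (cfDen a (t + 1) : ℝ) ^ 2 :=
    Finset.sum_nonneg fun i _ => by positivity
  refine ⟨1 + ∑ t ∈ Finset.range T, (cfDen a (t + 1) : ℝ) ^ 2, by linarith, fun t => ?_⟩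
  have h2 : (1 : ℝ) ≤ 2 ^ (∑ i ∈ Finset.range t, a i) := one_le_pow₀ one_le_two
  rcases le_or_gt T t with ht | ht
  · have := hT t ht
    nlinarith
  · have := Finset.single_le_sum (f := fun t => (cfDen a (t + 1) : ℝ) ^ 2)
      (fun i _ => by positivity) (Finset.mem_range.2 ht)
    nlinarith

theorem add_three_sq_le (k : ℕ) : ((k : ℝ) + 3) ^ 2 ≤ 9 * 2 ^ k := by
  induction k with
  | zero => norm_num
  | succ k ih =>
    rw [pow_succ (2 : ℝ) k]
    push_cast
    have : (0 : ℝ) ≤ k := by positivity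
    nlinarith

/-- Descend through the Stern–Brocot intervals containing `ξ 0` until a mediant separates y from it,
then apply `slope_le_of_separated`. The parameter n bounds the remaining descent, since widths
shrink with depth. At depth S_t + k the denominators sum to at most (k + 3) q_t, and (k + 3)^2 ≤ 9 ·
2^k yields a bound independent of k. -/
theorem slope_le_of_mem (h : IsCFExpansion a ξ) {T : ℕ} {ε y : ℝ}
    (hε : ∀ t, T ≤ t → (cfDen a (t + 1) : ℝ) ^ 2 / 2 ^ (∑ i ∈ Finset.range t, a i) ≤ ε)
    (n t k : ℕ) (ht : T ≤ t) (hk : k < a t)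
    (hy : y ∈ Set.uIcc ((cfNum a (t + 1) : ℝ) / cfDen a (t + 1))
      (((cfNum a t + (k + 1) * cfNum a (t + 1) : ℕ) : ℝ) /
        ((cfDen a t + (k + 1) * cfDen a (t + 1) : ℕ) : ℝ)))
    (hn : 1 / (((∑ i ∈ Finset.range t, a i + k + n : ℕ) : ℝ) + 1) < |y - ξ 0|) :
    |minkowskiQuestionMark y - minkowskiQuestionMark (ξ 0)| ≤ 9 * ε * |y - ξ 0| := by
  induction n generalizing t k with
  | zero =>
    exfalso
    have h1 := (sternBrocotAdj_convergent h.one_le t k).width_le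
    have h2 := Set.abs_sub_le_of_uIcc_subset_uIcc
      (Set.uIcc_subset_uIcc (h.mem_uIcc hk) hy)
    rw [abs_sub_comm ((cfNum a (t + 1) : ℝ) / cfDen a (t + 1))] at h1
    rw [add_zero] at hn
    linarith
  | succ n ih =>
    have hadj := sternBrocotAdj_convergent h.one_le t k
    have hbound : ((cfDen a (t + 1) : ℝ) + ((cfDen a t + (k + 1) * cfDen a (t + 1) : ℕ) : ℝ)) ^ 2 /
        2 ^ (∑ i ∈ Finset.range t, a i + k) ≤ 9 * ε := by
      have h1 : (cfDen a t : ℝ) ≤ cfDen a (t + 1) := by exact_mod_cast cfDen_le_succ h.one_le t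
      have h2 : (cfDen a (t + 1) : ℝ) + ((cfDen a t + (k + 1) * cfDen a (t + 1) : ℕ) : ℝ) ≤
          (k + 3) * cfDen a (t + 1) := by
        push_cast; nlinarith
      have h3 := hε t ht
      rw [div_le_iff₀ (by positivity)] at h3 ⊢
      calc _ ≤ ((k + 3) * (cfDen a (t + 1) : ℝ)) ^ 2 := by gcongr
        _ = ((k : ℝ) + 3) ^ 2 * (cfDen a (t + 1) : ℝ) ^ 2 := by ring
        _ ≤ (9 * 2 ^ k) * (ε * 2 ^ ∑ i ∈ Finset.range t, a i) :=
          mul_le_mul (add_three_sq_le k) h3 (by positivity) (by positivity)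
        _ = _ := by rw [pow_add]; ring
    have hfin := mul_le_mul_of_nonneg_right hbound (abs_nonneg (y - ξ 0))
    have hsplit := Set.uIcc_subset_uIcc_union_uIcc (b :=
      ((cfNum a (t + 1) + (cfNum a t + (k + 1) * cfNum a (t + 1)) : ℕ) : ℝ) /
      ((cfDen a (t + 1) + (cfDen a t + (k + 1) * cfDen a (t + 1)) : ℕ) : ℝ)) hy
    -- Either the next interval still has p_t/q_t as its fixed endpoint, or the digit `a t` is
    -- exhausted and the next interval is the one for t + 1 and k = 0, with endpoints swapped.
    rcases (Nat.succ_le_of_lt hk).lt_or_eq with hk' | hk'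
    · have hx := h.mem_uIcc hk'
      have e1 : cfNum a t + (k + 1 + 1) * cfNum a (t + 1) =
          cfNum a (t + 1) + (cfNum a t + (k + 1) * cfNum a (t + 1)) := by ring
      have e2 : cfDen a t + (k + 1 + 1) * cfDen a (t + 1) =
          cfDen a (t + 1) + (cfDen a t + (k + 1) * cfDen a (t + 1)) := by ring
      rcases hsplit with hy' | hy'
      · refine ih t (k + 1) ht hk' ?_ ?_
        · rw [e1, e2]; exact hy'
        · convert hn using 4
          ring
      · rw [Nat.succ_eq_add_one, e1, e2] at hx
        exact (hadj.slope_le_of_separated hx hy').trans hfin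
    · have hx := h.mem_uIcc (h.one_le (t + 1))
      have e0 : k + 1 = a t := hk'
      have e1 : cfNum a (t + 1) + (0 + 1) * cfNum a (t + 1 + 1) =
          cfNum a (t + 1) + (cfNum a t + (k + 1) * cfNum a (t + 1)) := by
        simp only [cfNum, e0]; ring
      have e2 : cfDen a (t + 1) + (0 + 1) * cfDen a (t + 1 + 1) =
          cfDen a (t + 1) + (cfDen a t + (k + 1) * cfDen a (t + 1)) := by
        simp only [cfDen, e0]; ring
      have e3 : cfNum a (t + 1 + 1) = cfNum a t + (k + 1) * cfNum a (t + 1) := by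
        simp only [cfNum, e0]; ring
      have e4 : cfDen a (t + 1 + 1) = cfDen a t + (k + 1) * cfDen a (t + 1) := by
        simp only [cfDen, e0]; ring
      rcases hsplit with hy' | hy'
      · rw [e1, e2, e3, e4, Set.uIcc_comm] at hx
        rw [abs_sub_comm, abs_sub_comm y]
        rw [abs_sub_comm y] at hfin
        exact (hadj.slope_le_of_separated hy' hx).trans hfin
      · refine ih (t + 1) 0 (by omega) (h.one_le (t + 1)) ?_ ?_
        · rw [e1, e2, e3, e4, Set.uIcc_comm]; exact hy'
        · rw [Finset.sum_range_succ, ← e0]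
          convert hn using 4
          ring

theorem hasDerivAt_zero (h : IsCFExpansion a ξ) (hx : Irrational (ξ 0))
    (hlim : Filter.Tendsto
      (fun t => (cfDen a (t + 1) : ℝ) ^ 2 / 2 ^ (∑ i ∈ Finset.range t, a i))
      Filter.atTop (nhds 0)) :
    HasDerivAt minkowskiQuestionMark 0 (ξ 0) := by
  rw [hasDerivAt_iff_isLittleO, Asymptotics.isLittleO_iff]
  intro c hc
  obtain ⟨T, hT⟩ := Filter.eventually_atTop.1 (hlim.eventually (gt_mem_nhds (show 0 < c / 9 by linarith)))
  have hmem := h.mem_uIcc (h.one_le T)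
  have hne (p q : ℕ) : ξ 0 ≠ (p : ℝ) / q := fun e => hx ⟨(p : ℚ) / q, by push_cast; exact e.symm⟩
  -- The endpoints are rational, so the irrational `ξ 0` is interior and the slope bound holds on a
  -- whole neighbourhood.
  have hnhds : Set.uIcc ((cfNum a (T + 1) : ℝ) / cfDen a (T + 1))
      (((cfNum a T + (0 + 1) * cfNum a (T + 1) : ℕ) : ℝ) /
        ((cfDen a T + (0 + 1) * cfDen a (T + 1) : ℕ) : ℝ)) ∈ nhds (ξ 0) := by
    refine Icc_mem_nhds (lt_of_le_of_ne hmem.1 ?_) (lt_of_le_of_ne hmem.2 ?_)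
    · rcases min_choice ((cfNum a (T + 1) : ℝ) / cfDen a (T + 1))
        (((cfNum a T + (0 + 1) * cfNum a (T + 1) : ℕ) : ℝ) /
        ((cfDen a T + (0 + 1) * cfDen a (T + 1) : ℕ) : ℝ)) with e | e <;> rw [e] <;>
        exact (hne _ _).symm
    · rcases max_choice ((cfNum a (T + 1) : ℝ) / cfDen a (T + 1))
        (((cfNum a T + (0 + 1) * cfNum a (T + 1) : ℕ) : ℝ) /
        ((cfDen a T + (0 + 1) * cfDen a (T + 1) : ℕ) : ℝ)) with e | e <;> rw [e] <;>
        exact hne _ _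
  filter_upwards [hnhds] with y hy
  simp only [smul_zero, sub_zero, Real.norm_eq_abs]
  rcases eq_or_ne y (ξ 0) with rfl | hyx
  · simp
  obtain ⟨n, hn⟩ := exists_nat_one_div_lt (abs_pos.2 (sub_ne_zero.2 hyx))
  have := h.slope_le_of_mem (ε := c / 9) (y := y) (fun t ht => (hT t ht).le) n T 0 le_rfl
    (h.one_le T) hy (lt_of_le_of_lt (one_div_le_one_div_of_le (by positivity)
      (by push_cast; gcongr; exact le_add_of_nonneg_left (by positivity))) hn)
  linarith

end IsCFExpansion

/-! ### Growth of the denominators against powers of the golden ratio -/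

theorem lambdaOne_sq : lambdaOne ^ 2 = lambdaOne + 1 := Real.goldenRatio_sq

theorem one_lt_lambdaOne : 1 < lambdaOne := Real.one_lt_goldenRatio

theorem lambdaOne_lt_two : lambdaOne < 2 := Real.goldenRatio_lt_two

theorem one_add_inv_lambdaOne : 1 + lambdaOne⁻¹ = lambdaOne := by
  have h := one_lt_lambdaOne
  have := lambdaOne_sq
  field_simp
  linarith

theorem log_two_lt : Real.log 2 < 2 * Real.log lambdaOne := by
  have h := one_lt_lambdaOne
  have e : 2 * Real.log lambdaOne = Real.log (lambdaOne ^ 2) := by rw [Real.log_pow]; norm_num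
  rw [e, lambdaOne_sq]
  exact Real.log_lt_log (by norm_num) (by linarith)

theorem one_lt_kappaOne : 1 < kappaOne := by
  unfold kappaOne
  rw [lt_div_iff₀ (Real.log_pos one_lt_two)]
  linarith [log_two_lt]

theorem kappaOne_mul_log_two : kappaOne * Real.log 2 = 2 * Real.log lambdaOne := by
  unfold kappaOne
  field_simp [(Real.log_pos one_lt_two).ne']

/-- Q_t = q_t + q_(t-1)/λ is an eigenfunctional of the step with digit 1, with eigenvalue λ; a
larger digit adds (a - 1) q_t. Since Q_t/λ ≤ q_t ≤ Q_t, one step multiplies Q by a factor between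
λ(1 + (a - 1)/λ^2) and λ(1 + (a - 1)/λ), which gives both product bounds. -/
theorem cfDen_weighted_succ (a : ℕ → ℕ) (t : ℕ) :
    (cfDen a (t + 2) : ℝ) + cfDen a (t + 1) / lambdaOne =
      lambdaOne * (cfDen a (t + 1) + cfDen a t / lambdaOne) + (a t - 1) * cfDen a (t + 1) := by
  have h := one_lt_lambdaOne
  have h1 := one_add_inv_lambdaOne
  simp only [cfDen]
  push_cast
  have : lambdaOne * (cfDen a t / lambdaOne) = (cfDen a t : ℝ) := by field_simp
  rw [mul_add, this, div_eq_mul_inv]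
  linear_combination (cfDen a (t + 1) : ℝ) * h1

theorem prod_le_cfDen {a : ℕ → ℕ} (ha : ∀ i, 1 ≤ a i) (t : ℕ) :
    lambdaOne ^ t * ∏ i ∈ Finset.range t, (1 + ((a i : ℝ) - 1) / lambdaOne ^ 2) ≤
      lambdaOne * cfDen a (t + 1) := by
  have h := one_lt_lambdaOne
  have h0 : 0 < lambdaOne := by linarith
  have hle (t : ℕ) : (cfDen a t : ℝ) ≤ cfDen a (t + 1) := by exact_mod_cast cfDen_le_succ ha t
  have hQ (t : ℕ) : (cfDen a (t + 1) : ℝ) + cfDen a t / lambdaOne ≤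
      lambdaOne * cfDen a (t + 1) := by
    have h1 := one_add_inv_lambdaOne
    have h2 : (cfDen a t : ℝ) / lambdaOne ≤ cfDen a (t + 1) * lambdaOne⁻¹ := by
      rw [div_eq_mul_inv]
      exact mul_le_mul_of_nonneg_right (hle t) (by positivity)
    have h3 : lambdaOne * (cfDen a (t + 1) : ℝ) =
      cfDen a (t + 1) + cfDen a (t + 1) * lambdaOne⁻¹ := by
      linear_combination -(cfDen a (t + 1) : ℝ) * h1
    linarith
  refine le_trans ?_ (hQ t)
  induction t with
  | zero => simp [cfDen]
  | succ t ih =>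
    have h1 : (1 : ℝ) ≤ a t := by exact_mod_cast ha t
    have h2 := hQ t
    rw [cfDen_weighted_succ, pow_succ, Finset.prod_range_succ]
    set Q : ℝ := (cfDen a (t + 1) : ℝ) + cfDen a t / lambdaOne
    calc _ = (lambdaOne ^ t * ∏ i ∈ Finset.range t, (1 + ((a i : ℝ) - 1) / lambdaOne ^ 2)) *
          (lambdaOne * (1 + ((a t : ℝ) - 1) / lambdaOne ^ 2)) := by ring
      _ ≤ Q * (lambdaOne * (1 + ((a t : ℝ) - 1) / lambdaOne ^ 2)) := by
        have : 0 ≤ ((a t : ℝ) - 1) / lambdaOne ^ 2 := div_nonneg (by linarith) (by positivity)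
        gcongr
      _ = lambdaOne * Q + ((a t : ℝ) - 1) * (Q / lambdaOne) := by field_simp
      _ ≤ _ := by
        have : Q / lambdaOne ≤ cfDen a (t + 1) := by
          rw [div_le_iff₀ h0]; linarith
        have := mul_le_mul_of_nonneg_left this (show 0 ≤ (a t : ℝ) - 1 by linarith)
        linarith

theorem cfDen_le_prod {a : ℕ → ℕ} (ha : ∀ i, 1 ≤ a i) (t : ℕ) :
    (cfDen a (t + 1) : ℝ) ≤
      lambdaOne ^ t * ∏ i ∈ Finset.range t, (1 + ((a i : ℝ) - 1) / lambdaOne) := by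
  have h := one_lt_lambdaOne
  have h0 : 0 < lambdaOne := by linarith
  have hQ (t : ℕ) : (cfDen a (t + 1) : ℝ) ≤ (cfDen a (t + 1) : ℝ) + cfDen a t / lambdaOne :=
    le_add_of_nonneg_right (by positivity)
  refine le_trans (hQ t) ?_
  induction t with
  | zero => simp [cfDen]
  | succ t ih =>
    have h1 : (1 : ℝ) ≤ a t := by exact_mod_cast ha t
    have h2 := hQ t
    rw [cfDen_weighted_succ, pow_succ, Finset.prod_range_succ]
    set Q : ℝ := (cfDen a (t + 1) : ℝ) + cfDen a t / lambdaOne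
    calc lambdaOne * Q + (a t - 1) * cfDen a (t + 1) ≤ lambdaOne * Q + ((a t : ℝ) - 1) * Q := by
          have := mul_le_mul_of_nonneg_left h2 (show 0 ≤ (a t : ℝ) - 1 by linarith)
          linarith
      _ = Q * (lambdaOne * (1 + ((a t : ℝ) - 1) / lambdaOne)) := by field_simp
      _ ≤ (lambdaOne ^ t * ∏ i ∈ Finset.range t, (1 + ((a i : ℝ) - 1) / lambdaOne)) *
          (lambdaOne * (1 + ((a t : ℝ) - 1) / lambdaOne)) := by
        have : 0 ≤ ((a t : ℝ) - 1) / lambdaOne := div_nonneg (by linarith) (by positivity)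
        gcongr
      _ = _ := by ring

theorem log_prod_le {a : ℕ → ℕ} (ha : ∀ i, 1 ≤ a i) (t : ℕ) :
    t * Real.log lambdaOne +
      ∑ i ∈ Finset.range t, Real.log (1 + ((a i : ℝ) - 1) / lambdaOne ^ 2) ≤
      Real.log lambdaOne + Real.log (cfDen a (t + 1)) := by
  have h := one_lt_lambdaOne
  have h0 : 0 < lambdaOne := by linarith
  have hpos (i : ℕ) : 0 < 1 + ((a i : ℝ) - 1) / lambdaOne ^ 2 := by
    have h1 : (1 : ℝ) ≤ a i := by exact_mod_cast ha i
    have : 0 ≤ ((a i : ℝ) - 1) / lambdaOne ^ 2 := div_nonneg (by linarith) (by positivity)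
    linarith
  have hq : (0 : ℝ) < cfDen a (t + 1) := by exact_mod_cast cfDen_succ_pos ha t
  rw [← Real.log_mul h0.ne' hq.ne', ← Real.log_prod fun i _ => (hpos i).ne', ← Real.log_pow,
    ← Real.log_mul (by positivity) (Finset.prod_pos fun i _ => hpos i).ne']
  exact Real.log_le_log (mul_pos (by positivity) (Finset.prod_pos fun i _ => hpos i))
    (prod_le_cfDen ha t)

theorem log_cfDen_le {a : ℕ → ℕ} (ha : ∀ i, 1 ≤ a i) (t : ℕ) :
    Real.log (cfDen a (t + 1)) ≤ t * Real.log lambdaOne +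
      ∑ i ∈ Finset.range t, Real.log (1 + ((a i : ℝ) - 1) / lambdaOne) := by
  have h := one_lt_lambdaOne
  have h0 : 0 < lambdaOne := by linarith
  have hpos (i : ℕ) : 0 < 1 + ((a i : ℝ) - 1) / lambdaOne := by
    have h1 : (1 : ℝ) ≤ a i := by exact_mod_cast ha i
    have : 0 ≤ ((a i : ℝ) - 1) / lambdaOne := div_nonneg (by linarith) (by positivity)
    linarith
  have hq : (0 : ℝ) < cfDen a (t + 1) := by exact_mod_cast cfDen_succ_pos ha t
  rw [← Real.log_prod fun i _ => (hpos i).ne', ← Real.log_pow,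
    ← Real.log_mul (by positivity) (Finset.prod_pos fun i _ => hpos i).ne']
  exact Real.log_le_log hq (cfDen_le_prod ha t)

/-! ### Agreement with `GenContFract`, and existence of expansions -/

theorem IsCFExpansion.shift {a : ℕ → ℕ} {ξ : ℕ → ℝ} (h : IsCFExpansion a ξ) :
    IsCFExpansion (fun i => a (i + 1)) fun i => ξ (i + 1) :=
  ⟨fun _ => h.pos _, fun _ => h.lt_one _, fun _ => h.mul_eq _⟩

theorem IsCFExpansion.inv_eq {a : ℕ → ℕ} {ξ : ℕ → ℝ} (h : IsCFExpansion a ξ) (i : ℕ) :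
    (ξ i)⁻¹ = a i + ξ (i + 1) := inv_eq_of_mul_eq_one_right (h.mul_eq i)

theorem IsCFExpansion.floor_inv {a : ℕ → ℕ} {ξ : ℕ → ℝ} (h : IsCFExpansion a ξ) (i : ℕ) :
    ⌊(ξ i)⁻¹⌋ = (a i : ℤ) := by
  rw [h.inv_eq, Int.floor_eq_iff]
  push_cast
  exact ⟨by linarith [h.pos (i + 1)], by linarith [h.lt_one (i + 1)]⟩

theorem IsCFExpansion.fract_inv {a : ℕ → ℕ} {ξ : ℕ → ℝ} (h : IsCFExpansion a ξ) (i : ℕ) :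
    Int.fract (ξ i)⁻¹ = ξ (i + 1) := by
  rw [Int.fract, h.floor_inv, h.inv_eq]
  push_cast; ring

/-- Shifting the stream of `ξ 0` yields that of `(ξ 0)⁻¹`, which differs from `ξ 1` by the integer
`a 0`; this lemma discards that integer. -/
theorem GenContFract.of_s_get?_eq_of_fract_eq {v w : ℝ} (h : Int.fract v = Int.fract w) (n : ℕ) :
    (GenContFract.of v).s.get? n = (GenContFract.of w).s.get? n := by
  cases n with
  | zero =>
    by_cases hv : Int.fract v = 0
    · obtain ⟨z, rfl⟩ : ∃ z : ℤ, v = z := ⟨⌊v⌋, by rw [Int.fract] at hv; linarith⟩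
      have hw : Int.fract w = 0 := by rw [← h]; exact hv
      obtain ⟨z', rfl⟩ : ∃ z : ℤ, w = z := ⟨⌊w⌋, by rw [Int.fract] at hw; linarith⟩
      simp [GenContFract.of_s_of_int]
    · have hw : Int.fract w ≠ 0 := by rw [← h]; exact hv
      have e1 := GenContFract.of_s_head hv
      have e2 := GenContFract.of_s_head hw
      rw [Stream'.Seq.head] at e1 e2
      rw [e1, e2, h]
  | succ n => rw [GenContFract.of_s_succ, GenContFract.of_s_succ, h]

theorem IsCFExpansion.s_get? {a : ℕ → ℕ} {ξ : ℕ → ℝ} (h : IsCFExpansion a ξ) (n : ℕ) :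
    (GenContFract.of (ξ 0)).s.get? n = some ⟨1, (a n : ℝ)⟩ := by
  have hf {a : ℕ → ℕ} {ξ : ℕ → ℝ} (h : IsCFExpansion a ξ) : Int.fract (ξ 0) = ξ 0 :=
    Int.fract_eq_self.2 ⟨(h.pos 0).le, h.lt_one 0⟩
  induction n generalizing a ξ with
  | zero =>
    have e1 := GenContFract.of_s_head (v := ξ 0) (by rw [hf h]; exact (h.pos 0).ne')
    rw [Stream'.Seq.head, hf h, h.floor_inv] at e1
    simpa using e1
  | succ n ih =>
    rw [GenContFract.of_s_succ, hf h, ← ih h.shift]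
    refine GenContFract.of_s_get?_eq_of_fract_eq ?_ n
    rw [h.fract_inv, hf h.shift]

theorem IsCFExpansion.partialQuotient_eq {a : ℕ → ℕ} {ξ : ℕ → ℝ} (h : IsCFExpansion a ξ) (n : ℕ) :
    partialQuotient (ξ 0) n = a n := by
  simp [partialQuotient, GenContFract.partDens, h.s_get? n]

theorem IsCFExpansion.irrational {a : ℕ → ℕ} {ξ : ℕ → ℝ} (h : IsCFExpansion a ξ) :
    Irrational (ξ 0) := by
  rintro ⟨r, hr⟩
  obtain ⟨n, hn⟩ := (GenContFract.terminates_iff_rat (ξ 0)).2 ⟨r, hr.symm⟩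
  have hn' : (GenContFract.of (ξ 0)).s.get? n = none := hn
  simp [h.s_get? n] at hn'

/-- The iterates of the Gauss map `x ↦ {1 / x}`. -/
noncomputable def gaussIterate (x : ℝ) : ℕ → ℝ
  | 0 => x
  | n + 1 => Int.fract (gaussIterate x n)⁻¹

theorem isCFExpansion_gaussIterate {x : ℝ} (hx : Irrational x) (h0 : 0 < x) (h1 : x < 1) :
    IsCFExpansion (fun i => ⌊(gaussIterate x i)⁻¹⌋₊) (gaussIterate x) := by
  have key (i : ℕ) : Irrational (gaussIterate x i) ∧ 0 < gaussIterate x i ∧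
      gaussIterate x i < 1 := by
    induction i with
    | zero => exact ⟨hx, h0, h1⟩
    | succ i ih =>
      have hirr : Irrational (gaussIterate x (i + 1)) := by
        simp only [gaussIterate, Int.fract]
        exact ih.1.inv.sub_intCast _
      exact ⟨hirr, lt_of_le_of_ne (Int.fract_nonneg _) hirr.ne_zero.symm, Int.fract_lt_one _⟩
  refine ⟨fun i => (key i).2.1, fun i => (key i).2.2, fun i => ?_⟩
  have hp := (key i).2.1
  have e : (⌊(gaussIterate x i)⁻¹⌋₊ : ℝ) = (⌊(gaussIterate x i)⁻¹⌋ : ℝ) :=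
    natCast_floor_eq_intCast_floor (by positivity)
  rw [gaussIterate, e, Int.floor_add_fract]
  exact mul_inv_cancel₀ hp.ne'

/-- The reals `[0; a 0, …, a (t - 1) + y]` with `y ∈ [0, 1]`. -/
def cfCylinder : ℕ → (ℕ → ℕ) → Set ℝ
  | 0, _ => Set.Icc 0 1
  | t + 1, a => (fun y : ℝ => ((a 0 : ℝ) + y)⁻¹) '' cfCylinder t fun i => a (i + 1)

theorem cfCylinder_subset_Icc {a : ℕ → ℕ} (ha : ∀ i, 1 ≤ a i) (t : ℕ) :
    cfCylinder t a ⊆ Set.Icc 0 1 := by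
  induction t generalizing a with
  | zero => exact subset_rfl
  | succ t ih =>
    rintro _ ⟨y, hy, rfl⟩
    have hy' := ih (fun i => ha (i + 1)) hy
    have h1 : (1 : ℝ) ≤ a 0 := by exact_mod_cast ha 0
    exact ⟨inv_nonneg.2 (by linarith [hy'.1]), inv_le_one_of_one_le₀ (by linarith [hy'.1])⟩

theorem cfCylinder_succ_subset {a : ℕ → ℕ} (ha : ∀ i, 1 ≤ a i) (t : ℕ) :
    cfCylinder (t + 1) a ⊆ cfCylinder t a := by
  induction t generalizing a with
  | zero => exact cfCylinder_subset_Icc ha 1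
  | succ t ih => exact Set.image_mono (ih fun i => ha (i + 1))

theorem isCompact_cfCylinder {a : ℕ → ℕ} (ha : ∀ i, 1 ≤ a i) (t : ℕ) :
    IsCompact (cfCylinder t a) := by
  induction t generalizing a with
  | zero => exact isCompact_Icc
  | succ t ih =>
    refine (ih fun i => ha (i + 1)).image_of_continuousOn ?_
    refine ContinuousOn.inv₀ (by fun_prop) fun y hy => ?_
    have hy' := cfCylinder_subset_Icc (fun i => ha (i + 1)) t hy
    have h1 : (1 : ℝ) ≤ a 0 := by exact_mod_cast ha 0
    linarith [hy'.1]

theorem cfCylinder_nonempty (a : ℕ → ℕ) (t : ℕ) : (cfCylinder t a).Nonempty := by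
  induction t generalizing a with
  | zero => exact ⟨0, by simp [cfCylinder]⟩
  | succ t ih => exact (ih _).image _

/-- A point in the intersection of the nested compact cylinders has the prescribed digits. Cylinders
are closed, so the strict bounds on `ξ i` are recovered afterwards from `ξ i * (a i + ξ (i + 1)) =
1`. -/
theorem exists_isCFExpansion {a : ℕ → ℕ} (ha : ∀ i, 1 ≤ a i) : ∃ ξ, IsCFExpansion a ξ := by
  obtain ⟨x, hx⟩ := IsCompact.nonempty_iInter_of_sequence_nonempty_isCompact_isClosed
    (fun t => cfCylinder t a) (fun t => cfCylinder_succ_subset ha t)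
    (fun t => cfCylinder_nonempty a t) (isCompact_cfCylinder ha 0)
    (fun t => (isCompact_cfCylinder ha t).isClosed)
  rw [Set.mem_iInter] at hx
  let ξ : ℕ → ℝ := fun n => n.rec x fun i y => y⁻¹ - a i
  have hξ (i : ℕ) : ξ (i + 1) = (ξ i)⁻¹ - a i := rfl
  have hmem (i : ℕ) : ∀ t, ξ i ∈ cfCylinder t fun j => a (i + j) := by
    induction i with
    | zero => simpa [ξ] using hx
    | succ i ih =>
      intro t
      obtain ⟨y, hy, e⟩ := ih (t + 1)
      have e' : ξ (i + 1) = y := by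
        rw [hξ, ← e, inv_inv]
        exact add_sub_cancel_left _ _
      have e'' : (fun j => a (i + 1 + j)) = fun j => a (i + (j + 1)) := by
        funext j; congr 1; omega
      rw [e', e'']
      exact hy
  have hIcc (i : ℕ) : 0 ≤ ξ i ∧ ξ i ≤ 1 := cfCylinder_subset_Icc (fun j => ha (i + j)) 0 (hmem i 0)
  have hpos (i : ℕ) : 0 < ξ i := by
    obtain ⟨y, hy, e⟩ := hmem i 1
    have h1 : (1 : ℝ) ≤ a (i + 0) := by exact_mod_cast ha _
    rw [← e]
    exact inv_pos.2 (by linarith [hy.1])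
  have hmul (i : ℕ) : ξ i * (a i + ξ (i + 1)) = 1 := by
    rw [hξ]
    have := hpos i
    field_simp
    ring
  refine ⟨ξ, hpos, fun i => ?_, hmul⟩
  have h1 : (1 : ℝ) ≤ a i := by exact_mod_cast ha _
  nlinarith [hmul i, hpos i, hpos (i + 1)]

theorem IsCFExpansion.partialQuotientSum_eq {a : ℕ → ℕ} {ξ : ℕ → ℝ} (h : IsCFExpansion a ξ)
    (t : ℕ) : partialQuotientSum (ξ 0) t = ∑ i ∈ Finset.range t, (a i : ℝ) :=
  Finset.sum_congr rfl fun i _ => h.partialQuotient_eq i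

/-! ### The lower bound for the maximal excess -/

theorem IsCFExpansion.excess_ge {a : ℕ → ℕ} {ξ : ℕ → ℝ} (h : IsCFExpansion a ξ)
    (hd : HasDerivAt minkowskiQuestionMark 0 (ξ 0)) :
    ∃ C, 0 ≤ C ∧ ∀ t : ℕ,
      2 / Real.log 2 * ∑ i ∈ Finset.range t, Real.log (1 + ((a i : ℝ) - 1) / lambdaOne ^ 2) - C ≤
        ∑ i ∈ Finset.range t, (a i : ℝ) - kappaOne * t := by
  obtain ⟨C, hC, hq⟩ := h.sq_cfDen_le hd
  have hl2 := Real.log_pos one_lt_two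
  have hla := Real.log_pos one_lt_lambdaOne
  have hk := kappaOne_mul_log_two
  refine ⟨(2 * Real.log lambdaOne + Real.log C) / Real.log 2,
    div_nonneg (by linarith [Real.log_nonneg hC]) hl2.le, fun t => ?_⟩
  have h1 := log_prod_le h.one_le t
  have hqpos : (0 : ℝ) < cfDen a (t + 1) := by exact_mod_cast cfDen_succ_pos h.one_le t
  have h2 := Real.log_le_log (by positivity) (hq t)
  rw [Real.log_mul (by positivity) (by positivity), Real.log_pow, Real.log_pow] at h2
  push_cast at h2
  rw [← mul_le_mul_iff_left₀ hl2]
  have e : (2 / Real.log 2 *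
      ∑ i ∈ Finset.range t, Real.log (1 + ((a i : ℝ) - 1) / lambdaOne ^ 2) -
      (2 * Real.log lambdaOne + Real.log C) / Real.log 2) * Real.log 2 =
      2 * ∑ i ∈ Finset.range t, Real.log (1 + ((a i : ℝ) - 1) / lambdaOne ^ 2) -
      (2 * Real.log lambdaOne + Real.log C) := by field_simp
  rw [e, sub_mul]
  have e2 : kappaOne * t * Real.log 2 = 2 * Real.log lambdaOne * t := by rw [← hk]; ring
  linarith

/-- The chord of the concave function b ↦ log(1 + b/L) over [0, B], via Bernoulli's inequality. -/
theorem div_mul_log_le_log {b B L : ℝ} (hb : 0 ≤ b) (hbB : b ≤ B) (hB : 0 < B) (hL : 0 < L) :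
    b / B * Real.log (1 + B / L) ≤ Real.log (1 + b / L) := by
  have h0 : 0 < B / L := by positivity
  have h := rpow_one_add_le_one_add_mul_self (s := B / L) (p := b / B) (by linarith)
    (by positivity) ((div_le_one hB).2 hbB)
  rw [← Real.log_rpow (by linarith)]
  refine Real.log_le_log (by positivity) (h.trans_eq ?_)
  field_simp

/-- The excess is always at least -C and at most M up to t, so no single digit exceeds M + C + κ =:
B. The chord bound then makes the sum of logarithms at least log(1 + B/λ^2)/B times the sum of the
a_i - 1, which is at least (κ - 1)t - C. -/
theorem excess_bound_sq_ge {a : ℕ → ℕ} (ha : ∀ i, 1 ≤ a i) {C : ℝ}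
    (h : ∀ t : ℕ,
      2 / Real.log 2 * ∑ i ∈ Finset.range t, Real.log (1 + ((a i : ℝ) - 1) / lambdaOne ^ 2) - C ≤
        ∑ i ∈ Finset.range t, (a i : ℝ) - kappaOne * t)
    {t : ℕ} (ht : 1 ≤ t) {M : ℝ}
    (hM : ∀ u, 1 ≤ u → u ≤ t → ∑ i ∈ Finset.range u, (a i : ℝ) - kappaOne * u ≤ M) :
    1 ≤ M + C + kappaOne ∧
      2 / Real.log 2 * ((kappaOne - 1) * t - C) *
        Real.log (1 + (M + C + kappaOne) / lambdaOne ^ 2) ≤ (M + C + kappaOne) ^ 2 := by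
  have hl2 := Real.log_pos one_lt_two
  have hlam := one_lt_lambdaOne
  have hk := one_lt_kappaOne
  have ha' (i : ℕ) : (1 : ℝ) ≤ a i := by exact_mod_cast ha i
  have hfnn (i : ℕ) : 0 ≤ Real.log (1 + ((a i : ℝ) - 1) / lambdaOne ^ 2) :=
    Real.log_nonneg (le_add_of_nonneg_right (div_nonneg (by linarith [ha' i]) (by positivity)))
  have hD (u : ℕ) : -C ≤ ∑ i ∈ Finset.range u, (a i : ℝ) - kappaOne * u := by
    refine le_trans ?_ (h u)
    have := mul_nonneg (div_pos two_pos hl2).le (Finset.sum_nonneg fun i (_ : i ∈ Finset.range u) =>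
      hfnn i)
    linarith
  have h1 : 1 ≤ M + C + kappaOne := by linarith [hD 1, hM 1 le_rfl ht]
  refine ⟨h1, ?_⟩
  set B := M + C + kappaOne with hBdef
  have hB : 0 < B := by linarith
  have hai (i : ℕ) (hi : i < t) : (a i : ℝ) - 1 ≤ B := by
    have h2 := hM (i + 1) (by omega) hi
    have h3 := hD i
    rw [Finset.sum_range_succ] at h2
    push_cast at h2
    linarith
  set ℓ := Real.log (1 + B / lambdaOne ^ 2) with hℓ
  have hℓ0 : 0 ≤ ℓ := Real.log_nonneg (le_add_of_nonneg_right (by positivity))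
  have hsum : (∑ i ∈ Finset.range t, ((a i : ℝ) - 1)) / B * ℓ ≤
      ∑ i ∈ Finset.range t, Real.log (1 + ((a i : ℝ) - 1) / lambdaOne ^ 2) := by
    rw [Finset.sum_div, Finset.sum_mul]
    refine Finset.sum_le_sum fun i hi => ?_
    exact div_mul_log_le_log (by linarith [ha' i]) (hai i (Finset.mem_range.1 hi)) hB
      (by positivity)
  have hsub : ∑ i ∈ Finset.range t, ((a i : ℝ) - 1) = ∑ i ∈ Finset.range t, (a i : ℝ) - t := by
    simp [Finset.sum_sub_distrib]
  have h4 : ((kappaOne - 1) * t - C) / B * ℓ ≤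
      ∑ i ∈ Finset.range t, Real.log (1 + ((a i : ℝ) - 1) / lambdaOne ^ 2) := by
    refine le_trans ?_ hsum
    rw [hsub]
    have := hD t
    exact mul_le_mul_of_nonneg_right
      (div_le_div_of_nonneg_right (by linarith) hB.le) hℓ0
  have h5 := mul_le_mul_of_nonneg_left h4 (div_pos two_pos hl2).le
  have h6 := h t
  have h7 := hM t ht le_rfl
  have h8 : 2 / Real.log 2 * (((kappaOne - 1) * t - C) / B * ℓ) ≤ B := by linarith
  calc _ = 2 / Real.log 2 * (((kappaOne - 1) * t - C) / B * ℓ) * B := by field_simp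
    _ ≤ B * B := by gcongr
    _ = B ^ 2 := by ring

theorem coeff_sq : (Real.sqrt (2 * Real.log lambdaOne - Real.log 2) / Real.log 2) ^ 2 =
    (kappaOne - 1) / Real.log 2 := by
  have hl2 := Real.log_pos one_lt_two
  rw [div_pow, Real.sq_sqrt (by linarith [log_two_lt]), ← kappaOne_mul_log_two]
  field_simp

theorem coeff_pos : 0 < Real.sqrt (2 * Real.log lambdaOne - Real.log 2) / Real.log 2 :=
  div_pos (Real.sqrt_pos.2 (by linarith [log_two_lt])) (Real.log_pos one_lt_two)

open Filter in
/-- Solving `B² ≥ (2 c² t - O(1)) log (1 + B / L)` for `B`. -/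
theorem eventually_ge_of_sq_ge {c s C K L : ℝ} (hc : 0 < c) (hL : 0 < L) :
    ∀ᶠ t : ℕ in atTop, ∀ B : ℝ, 1 ≤ B →
      (2 * c ^ 2 * t - s * C) * Real.log (1 + B / L) ≤ B ^ 2 →
      c * Real.sqrt (t * Real.log t) * (1 - (Real.sqrt (Real.log t))⁻¹) ≤ B - K := by
  set e0 := Real.log (1 + 1 / L) with he0
  have he0pos : 0 < e0 := Real.log_pos (by have : 0 < 1 / L := by positivity
                                           linarith)
  set e1 := Real.log (c * Real.sqrt e0 / L) with he1
  have hcast := tendsto_natCast_atTop_atTop (R := ℝ)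
  have hlog := Real.tendsto_log_atTop.comp hcast
  have hsqrtlog := Real.tendsto_sqrt_atTop.comp hlog
  have hsqrt := Real.tendsto_sqrt_atTop.comp hcast
  have hlo : ∀ᶠ t : ℕ in atTop, s * C * (1 / 2 * Real.log t + e1) ≤ c ^ 2 * t := by
    have h1 : Tendsto (fun t : ℝ => s * C / 2 * (Real.log t / t) + s * C * e1 * t⁻¹) atTop
        (nhds (s * C / 2 * 0 + s * C * e1 * 0)) := by
      refine Tendsto.add (Tendsto.const_mul _ ?_) (tendsto_inv_atTop_zero.const_mul _)
      simpa using Real.isLittleO_log_id_atTop.tendsto_div_nhds_zero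
    have h2 := (h1.comp hcast).eventually (ge_mem_nhds
      (show s * C / 2 * 0 + s * C * e1 * 0 < c ^ 2 by
        rw [mul_zero, mul_zero, add_zero]; positivity))
    filter_upwards [h2, eventually_gt_atTop 0] with t ht ht0
    have : (0 : ℝ) < t := by exact_mod_cast ht0
    simp only [Function.comp] at ht
    calc _ = (s * C / 2 * (Real.log t / t) + s * C * e1 * (t : ℝ)⁻¹) * t := by field_simp
      _ ≤ _ := by gcongr
  filter_upwards [hlo, eventually_gt_atTop 1, hcast.eventually_ge_atTop (s * C / c ^ 2),
    hsqrtlog.eventually_ge_atTop (5 / 4 - 2 * e1), hsqrtlog.eventually_ge_atTop 1,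
    hsqrt.eventually_ge_atTop (2 * K / c), hlog.eventually_ge_atTop (-2 * e1)] with
    t h1 h2 h3 h4 h4' h5 h6 B hB hB2
  simp only [Function.comp] at h3 h4 h4' h5 h6
  have ht0 : (1 : ℝ) < t := by exact_mod_cast h2
  have hy : 0 < Real.log t := Real.log_pos ht0
  rw [div_le_iff₀ (by positivity)] at h3
  rw [div_le_iff₀ hc] at h5
  -- Bootstrap: B ≥ 1 bounds the logarithm below by a constant, hence B is at least a multiple of
  -- √t, hence the logarithm is at least (log t)/2 + e1.
  have hmono : e0 ≤ Real.log (1 + B / L) :=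
    Real.log_le_log (by positivity) (by gcongr)
  have hB3 : c ^ 2 * t * e0 ≤ B ^ 2 := by
    refine le_trans ?_ hB2
    have : c ^ 2 * t ≤ 2 * c ^ 2 * t - s * C := by linarith
    gcongr
    linarith [show 0 ≤ c ^ 2 * t by positivity]
  have hB4 : c * Real.sqrt e0 * Real.sqrt t ≤ B := by
    refine le_of_sq_le_sq ?_ (by linarith)
    rw [mul_pow, mul_pow, Real.sq_sqrt he0pos.le, Real.sq_sqrt (by linarith)]
    linarith
  have hlogB : 1 / 2 * Real.log t + e1 ≤ Real.log (1 + B / L) := by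
    have e : 1 / 2 * Real.log t + e1 = Real.log (c * Real.sqrt e0 * Real.sqrt t / L) := by
      rw [mul_div_right_comm, Real.log_mul (by positivity) (by positivity),
        Real.log_sqrt (by linarith)]
      ring
    rw [e]
    refine Real.log_le_log (by positivity) ?_
    have : c * Real.sqrt e0 * Real.sqrt t / L ≤ B / L := by gcongr
    linarith
  have hB5 : (2 * c ^ 2 * t - s * C) * (1 / 2 * Real.log t + e1) ≤ B ^ 2 := by
    refine le_trans ?_ hB2
    have : 0 ≤ 2 * c ^ 2 * t - s * C := by nlinarith [show 0 ≤ c ^ 2 * t by positivity]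
    gcongr
  set r := Real.sqrt (Real.log t) with hr
  have hrr : r ^ 2 = Real.log t := Real.sq_sqrt hy.le
  have hr0 : 0 < r := by linarith
  have hgoal : c * Real.sqrt (t * Real.log t) * (1 - r⁻¹) = c * Real.sqrt t * (r - 1) := by
    rw [Real.sqrt_mul (by linarith), ← hr]
    field_simp
  rw [hgoal]
  -- With r = √(log t), B^2 ≥ c^2 t (r^2 + 2 e1 - 1), and this dominates c^2 t (r - 1/2)^2 once r ≥
  -- 5/4 - 2 e1. The other half of the loss in r - 1 absorbs K.
  have hfin : c * Real.sqrt t * (r - 1 / 2) ≤ B := by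
    refine le_of_sq_le_sq ?_ (by linarith)
    rw [mul_pow, mul_pow, Real.sq_sqrt (by linarith)]
    refine le_trans ?_ hB5
    rw [← hrr] at h1 ⊢
    have h0 : 0 < c ^ 2 * t := by positivity
    have h7 : 0 ≤ c ^ 2 * t * (r - (5 / 4 - 2 * e1)) := mul_nonneg h0.le (by linarith)
    nlinarith
  nlinarith

open Filter in
theorem excess_lower_bound {x : ℝ} (hx : Irrational x) (h01 : x ∈ Set.Ioo (0 : ℝ) 1)
    (hd : HasDerivAt minkowskiQuestionMark 0 x) {ψ : ℕ → ℝ}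
    (hψ : Asymptotics.IsLittleO atTop ψ
      (fun t : ℕ => Real.log (Real.log (t : ℝ)) / Real.log (t : ℝ))) :
    ∃ T : ℕ, ∀ t : ℕ, T ≤ t →
      ∃ M : ℝ,
        IsGreatest ((fun u : ℕ => partialQuotientSum x u - kappaOne * (u : ℝ)) ''
          Set.Icc 1 t) M ∧
        Real.sqrt (2 * Real.log lambdaOne - Real.log 2) / Real.log 2 *
            Real.sqrt ((t : ℝ) * Real.log (t : ℝ)) * (1 - (t : ℝ) ^ (-ψ t)) ≤ M := by
  have h := isCFExpansion_gaussIterate hx h01.1 h01.2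
  have hl2 := Real.log_pos one_lt_two
  obtain ⟨C, hC, hlow⟩ := h.excess_ge hd
  have hev := eventually_ge_of_sq_ge (s := 2 / Real.log 2) (C := C) (K := C + kappaOne) coeff_pos
    (show 0 < lambdaOne ^ 2 from pow_pos (by linarith [one_lt_lambdaOne]) 2)
  have hcast := tendsto_natCast_atTop_atTop (R := ℝ)
  have hlog := Real.tendsto_log_atTop.comp hcast
  have hψ' := hψ.bound (c := 1 / 2) (by norm_num)
  refine eventually_atTop.1 ?_
  filter_upwards [hev, hψ', eventually_ge_atTop 2, hlog.eventually_ge_atTop 1] with t h1 h2 h3 h4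
  simp only [Function.comp] at h4
  have ht : (2 : ℝ) ≤ t := by exact_mod_cast h3
  obtain ⟨M, hM⟩ := ((Set.finite_Icc 1 t).image
    (fun u : ℕ => partialQuotientSum x u - kappaOne * (u : ℝ))).isCompact.exists_isGreatest
    ((Set.nonempty_Icc.2 (by omega)).image _)
  refine ⟨M, hM, ?_⟩
  have hM' : ∀ u, 1 ≤ u → u ≤ t →
      ∑ i ∈ Finset.range u, ((⌊(gaussIterate x i)⁻¹⌋₊ : ℕ) : ℝ) - kappaOne * u ≤ M := by
    intro u hu hut
    rw [← h.partialQuotientSum_eq u]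
    exact hM.2 ⟨u, ⟨hu, hut⟩, rfl⟩
  obtain ⟨b1, b2⟩ := excess_bound_sq_ge h.one_le hlow (by omega) hM'
  have b3 := h1 _ b1 (by
    refine le_trans (le_of_eq ?_) b2
    rw [coeff_sq]
    congr 1
    field_simp)
  -- Eventually ψ ≤ (1/2) log log t / log t, and t raised to minus that bound is exactly (log
  -- t)^(-1/2).
  have b4 : (Real.sqrt (Real.log t))⁻¹ ≤ (t : ℝ) ^ (-ψ t) := by
    have hll : 0 ≤ Real.log (Real.log t) := Real.log_nonneg h4
    rw [Real.norm_eq_abs, Real.norm_eq_abs, abs_of_nonneg (div_nonneg hll (by linarith))] at h2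
    have h5 : ψ t ≤ 1 / 2 * (Real.log (Real.log t) / Real.log t) := (le_abs_self _).trans h2
    have h6 : Real.log t * ψ t ≤ 1 / 2 * Real.log (Real.log t) := by
      calc _ ≤ Real.log t * (1 / 2 * (Real.log (Real.log t) / Real.log t)) := by gcongr
        _ = _ := by field_simp
    rw [Real.rpow_def_of_pos (by linarith), Real.sqrt_eq_rpow,
      ← Real.rpow_neg (by linarith), Real.rpow_def_of_pos (by linarith)]
    refine Real.exp_le_exp.2 ?_
    linarith
  have b5 : 0 ≤ Real.sqrt (2 * Real.log lambdaOne - Real.log 2) / Real.log 2 *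
            Real.sqrt ((t : ℝ) * Real.log (t : ℝ)) := by positivity
  have b6 := mul_le_mul_of_nonneg_left (sub_le_sub_left b4 1) b5
  linarith

/-! ### The digit sequence with sparse jumps -/

open Classical in
/-- The digit sequence equal to `1` except for the digits `1 + b k` at the positions `n k`. -/
noncomputable def sparseDigits (n b : ℕ → ℕ) (i : ℕ) : ℕ :=
  if h : ∃ k, n k = i then 1 + b h.choose else 1

theorem sparseDigits_apply {n : ℕ → ℕ} (hn : StrictMono n) (b : ℕ → ℕ) (k : ℕ) :
    sparseDigits n b (n k) = 1 + b k := by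
  have h : ∃ j, n j = n k := ⟨k, rfl⟩
  rw [sparseDigits, dif_pos h, hn.injective h.choose_spec]

theorem sparseDigits_eq_one {n : ℕ → ℕ} (b : ℕ → ℕ) {i : ℕ} (h : ∀ k, n k ≠ i) :
    sparseDigits n b i = 1 := by
  rw [sparseDigits, dif_neg (by simpa using h)]

theorem one_le_sparseDigits (n b : ℕ → ℕ) (i : ℕ) : 1 ≤ sparseDigits n b i := by
  unfold sparseDigits
  split_ifs <;> omega

theorem sum_sparseDigits {n : ℕ → ℕ} (hn : StrictMono n) (b : ℕ → ℕ) {F : ℕ → ℝ} (hF : F 1 = 0)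
    {t k : ℕ} (h1 : n k < t) (h2 : t ≤ n (k + 1)) :
    ∑ i ∈ Finset.range t, F (sparseDigits n b i) = ∑ j ∈ Finset.range (k + 1), F (1 + b j) := by
  have hsub : (Finset.range (k + 1)).image n ⊆ Finset.range t := by
    intro i hi
    obtain ⟨j, hj, rfl⟩ := Finset.mem_image.1 hi
    have := hn.monotone (Nat.lt_succ_iff.1 (Finset.mem_range.1 hj))
    exact Finset.mem_range.2 (by omega)
  rw [← Finset.sum_subset hsub, Finset.sum_image hn.injective.injOn]
  · exact Finset.sum_congr rfl fun j _ => by rw [sparseDigits_apply hn]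
  · intro i hi hni
    rw [sparseDigits_eq_one, hF]
    rintro j rfl
    refine hni (Finset.mem_image_of_mem n (Finset.mem_range.2 ?_))
    exact hn.lt_iff_lt.1 ((Finset.mem_range.1 hi).trans_le h2)

theorem exists_block {n : ℕ → ℕ} (hn : StrictMono n) (h0 : n 0 = 0) {t : ℕ} (ht : 1 ≤ t) :
    ∃ k, n k < t ∧ t ≤ n (k + 1) := by
  classical
  have hex : ∃ k, t ≤ n (k + 1) := ⟨t, (Nat.le_succ t).trans (hn.id_le (t + 1))⟩
  refine ⟨Nat.find hex, ?_, Nat.find_spec hex⟩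
  cases hk : Nat.find hex with
  | zero => omega
  | succ m =>
    have := Nat.find_min hex (m := m) (by omega)
    omega

/-- `2 / log 2`. -/
noncomputable def jumpScale : ℝ := 2 / Real.log 2

theorem jumpScale_ge : 2 ≤ jumpScale := by
  have := Real.log_two_lt_d9
  rw [jumpScale, le_div_iff₀ (Real.log_pos one_lt_two)]
  linarith

theorem jumpScale_le : jumpScale ≤ 29 / 10 := by
  have := Real.log_two_gt_d9
  rw [jumpScale, div_le_iff₀ (Real.log_pos one_lt_two)]
  linarith

theorem jumpScale_mul_log_two : jumpScale * Real.log 2 = 2 :=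
  div_mul_cancel₀ _ (Real.log_pos one_lt_two).ne'

theorem kappaOne_lt_two : kappaOne < 2 := by
  have := Real.log_lt_log (by linarith [one_lt_lambdaOne]) lambdaOne_lt_two
  unfold kappaOne
  rw [div_lt_iff₀ (Real.log_pos one_lt_two)]
  linarith

/-- Size of the `k`-th jump. -/
noncomputable def jump (k : ℕ) : ℕ := ⌈jumpScale * (k * Real.log k)⌉₊ + 20

/-- Loss caused by the `k`-th jump, in the scale of the excess `S - κ₁ t`. -/
noncomputable def jumpCost (k : ℕ) : ℝ := jumpScale * Real.log (1 + jump k / lambdaOne)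

/-- Position of the `k`-th jump. -/
noncomputable def jumpPos : ℕ → ℕ
  | 0 => 0
  | k + 1 => ⌊(∑ j ∈ Finset.range (k + 1), ((jump j : ℝ) - jumpCost j - 1)) / (kappaOne - 1)⌋₊

theorem log_nat_nonneg (k : ℕ) : 0 ≤ Real.log k := Real.log_natCast_nonneg k

theorem jump_ge (k : ℕ) : jumpScale * (k * Real.log k) ≤ jump k := by
  rw [jump]
  push_cast
  linarith [Nat.le_ceil (jumpScale * (k * Real.log k))]

theorem jump_le (k : ℕ) : (jump k : ℝ) ≤ jumpScale * (k * Real.log k) + 21 := by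
  have h : 0 ≤ jumpScale * (k * Real.log k) :=
    mul_nonneg (by linarith [jumpScale_ge]) (mul_nonneg (by positivity) (log_nat_nonneg k))
  rw [jump]
  push_cast
  linarith [Nat.ceil_lt_add_one h]

theorem twenty_le_jump (k : ℕ) : (20 : ℝ) ≤ jump k := by
  exact_mod_cast (Nat.le_add_left 20 _ : 20 ≤ jump k)

theorem jump_mono : Monotone jump := by
  intro i j hij
  rcases Nat.eq_zero_or_pos i with rfl | hi
  · simp [jump]
  have hs := jumpScale_ge
  have := log_nat_nonneg i
  have hi' : (0 : ℝ) < i := by exact_mod_cast hi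
  unfold jump
  gcongr

theorem jumpCost_le_log (k : ℕ) : jumpCost k ≤ jumpScale * Real.log (1 + jump k) := by
  have h := one_lt_lambdaOne
  have hs := jumpScale_ge
  have : (jump k : ℝ) / lambdaOne ≤ jump k := div_le_self (by positivity) h.le
  unfold jumpCost
  have h0 : (0 : ℝ) ≤ jump k := by positivity
  have : 0 ≤ (jump k : ℝ) / lambdaOne := by positivity
  gcongr

/-- Each jump pays for its cost, its unit of slack and at least one step of drift, so the positions
strictly increase. The summand 20 in `jump` makes this hold for every k, through the tangent of log
at 8. -/
theorem jumpCost_add_le (k : ℕ) : jumpCost k + 1 + (kappaOne - 1) ≤ jump k := by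
  have h20 := twenty_le_jump k
  have hs := jumpScale_ge
  have hs' := jumpScale_le
  have h1 : Real.log (1 + jump k) ≤ (1 + jump k) / 8 - 1 + 3 * Real.log 2 := by
    have := Real.log_le_sub_one_of_pos (show (0 : ℝ) < (1 + jump k) / 8 by positivity)
    rw [Real.log_div (by positivity) (by norm_num), show (8 : ℝ) = 2 ^ 3 by norm_num,
      Real.log_pow] at this
    push_cast at this
    linarith
  have h2 := jumpCost_le_log k
  have h3 := mul_le_mul_of_nonneg_left h1 (show 0 ≤ jumpScale by linarith)
  have h4 := mul_le_mul_of_nonneg_right hs'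
    (show (0 : ℝ) ≤ (1 + jump k) / 8 - 1 by linarith)
  have h5 := jumpScale_mul_log_two
  have h6 := kappaOne_lt_two
  linarith

theorem jumpPos_strictMono : StrictMono jumpPos := by
  have hk := one_lt_kappaOne
  have hδ : 0 < kappaOne - 1 := by linarith
  have hterm (k : ℕ) : 1 ≤ ((jump k : ℝ) - jumpCost k - 1) / (kappaOne - 1) := by
    rw [le_div_iff₀ hδ]
    linarith [jumpCost_add_le k]
  refine strictMono_nat_of_lt_succ fun k => ?_
  cases k with
  | zero =>
    simp only [jumpPos, zero_add, Finset.sum_range_one]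
    exact Nat.floor_pos.2 (hterm 0)
  | succ k =>
    simp only [jumpPos]
    rw [Finset.sum_range_succ _ (k + 1), add_div]
    have hnn : 0 ≤ (∑ j ∈ Finset.range (k + 1), ((jump j : ℝ) - jumpCost j - 1)) /
        (kappaOne - 1) := by
      rw [Finset.sum_div]
      exact Finset.sum_nonneg fun j _ => zero_le_one.trans (hterm j)
    refine Nat.lt_of_succ_le ?_
    rw [Nat.succ_eq_add_one, ← Nat.floor_add_one hnn]
    exact Nat.floor_mono (by linarith [hterm (k + 1)])

theorem jumpPos_succ_le (k : ℕ) : (kappaOne - 1) * jumpPos (k + 1) ≤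
    ∑ j ∈ Finset.range (k + 1), ((jump j : ℝ) - jumpCost j - 1) := by
  have hδ : 0 < kappaOne - 1 := by linarith [one_lt_kappaOne]
  have hnn : 0 ≤ (∑ j ∈ Finset.range (k + 1), ((jump j : ℝ) - jumpCost j - 1)) /
      (kappaOne - 1) :=
    div_nonneg (Finset.sum_nonneg fun j _ => by linarith [jumpCost_add_le j]) hδ.le
  have := Nat.floor_le hnn
  rw [le_div_iff₀ hδ] at this
  rw [mul_comm]
  exact this

theorem lt_jumpPos_succ (k : ℕ) : ∑ j ∈ Finset.range (k + 1), ((jump j : ℝ) - jumpCost j - 1) ≤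
    (kappaOne - 1) * (jumpPos (k + 1) + 1) := by
  have hδ : 0 < kappaOne - 1 := by linarith [one_lt_kappaOne]
  have := (Nat.lt_floor_add_one ((∑ j ∈ Finset.range (k + 1),
    ((jump j : ℝ) - jumpCost j - 1)) / (kappaOne - 1))).le
  rw [div_le_iff₀ hδ] at this
  rw [mul_comm]
  exact this

/-- The partial quotients of the number constructed for the upper bound. -/
noncomputable def jumpDigits : ℕ → ℕ := sparseDigits jumpPos jump

theorem one_le_jumpDigits (i : ℕ) : 1 ≤ jumpDigits i := one_le_sparseDigits _ _ i

theorem sum_jumpDigits {t k : ℕ} (h1 : jumpPos k < t) (h2 : t ≤ jumpPos (k + 1)) :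
    ∑ i ∈ Finset.range t, (jumpDigits i : ℝ) =
      t + ∑ j ∈ Finset.range (k + 1), (jump j : ℝ) := by
  have h := sum_sparseDigits jumpPos_strictMono jump (F := fun i => (i : ℝ) - 1) (by simp) h1 h2
  simp only [Finset.sum_sub_distrib, Finset.sum_const, Finset.card_range, nsmul_eq_mul,
    mul_one] at h
  push_cast at h
  rw [Finset.sum_add_distrib] at h
  simp only [Finset.sum_const, Finset.card_range, nsmul_eq_mul, mul_one] at h
  push_cast at h
  unfold jumpDigits
  linarith

theorem sum_log_jumpDigits {t k : ℕ} (h1 : jumpPos k < t) (h2 : t ≤ jumpPos (k + 1)) :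
    jumpScale * ∑ i ∈ Finset.range t, Real.log (1 + ((jumpDigits i : ℝ) - 1) / lambdaOne) =
      ∑ j ∈ Finset.range (k + 1), jumpCost j := by
  have h := sum_sparseDigits jumpPos_strictMono jump
    (F := fun i => Real.log (1 + ((i : ℝ) - 1) / lambdaOne)) (by simp) h1 h2
  unfold jumpDigits
  rw [h, Finset.mul_sum]
  refine Finset.sum_congr rfl fun j _ => ?_
  unfold jumpCost
  push_cast
  rw [add_sub_cancel_left]

/-- The factor 2^(k + 1) is the one unit of slack that `jumpPos` reserves for each of the k + 1
jumps so far. -/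
theorem sq_cfDen_jumpDigits_mul_le {t k : ℕ} (h1 : jumpPos k < t) (h2 : t ≤ jumpPos (k + 1)) :
    (cfDen jumpDigits (t + 1) : ℝ) ^ 2 * 2 ^ (k + 1) ≤
      2 ^ (∑ i ∈ Finset.range t, jumpDigits i) := by
  have hl2 := Real.log_pos one_lt_two
  have hδ : 0 < kappaOne - 1 := by linarith [one_lt_kappaOne]
  have hq : (0 : ℝ) < cfDen jumpDigits (t + 1) := by
    exact_mod_cast cfDen_succ_pos one_le_jumpDigits t
  rw [← Real.log_le_log_iff (by positivity) (by positivity),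
    Real.log_mul (by positivity) (by positivity), Real.log_pow, Real.log_pow, Real.log_pow]
  push_cast
  rw [sum_jumpDigits h1 h2]
  have e1 := log_cfDen_le one_le_jumpDigits t
  have e2 := sum_log_jumpDigits h1 h2
  have e3 := jumpPos_succ_le k
  have e4 : (kappaOne - 1) * t ≤ (kappaOne - 1) * jumpPos (k + 1) := by
    have : (t : ℝ) ≤ jumpPos (k + 1) := by exact_mod_cast h2
    gcongr
  simp only [Finset.sum_sub_distrib, Finset.sum_const, Finset.card_range, nsmul_eq_mul,
    mul_one] at e3
  push_cast at e3
  have e5 := kappaOne_mul_log_two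
  have e6 := jumpScale_mul_log_two
  set W := ∑ i ∈ Finset.range t, Real.log (1 + ((jumpDigits i : ℝ) - 1) / lambdaOne)
  have e7 : 2 * W = Real.log 2 * ∑ j ∈ Finset.range (k + 1), jumpCost j := by
    rw [← e2]; linear_combination -W * e6
  have e8 : Real.log 2 * ((kappaOne - 1) * t + ∑ j ∈ Finset.range (k + 1), jumpCost j + (k + 1)) ≤
      Real.log 2 * ∑ j ∈ Finset.range (k + 1), (jump j : ℝ) := by
    gcongr
    linarith
  have e9 : (t : ℝ) * (kappaOne * Real.log 2) = t * (2 * Real.log lambdaOne) := by rw [e5]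
  linarith

open Filter in
theorem tendsto_sq_cfDen_jumpDigits :
    Tendsto (fun t => (cfDen jumpDigits (t + 1) : ℝ) ^ 2 /
      2 ^ (∑ i ∈ Finset.range t, jumpDigits i)) atTop (nhds 0) := by
  rw [Metric.tendsto_atTop]
  intro ε hε
  obtain ⟨K, hK⟩ := exists_pow_lt_of_lt_one hε (show (1 / 2 : ℝ) < 1 by norm_num)
  refine ⟨jumpPos K + 1, fun t ht => ?_⟩
  obtain ⟨k, h1, h2⟩ := exists_block jumpPos_strictMono rfl (t := t) (by omega)
  have hKk : K < k + 1 := jumpPos_strictMono.lt_iff_lt.1 (by omega)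
  have h := sq_cfDen_jumpDigits_mul_le h1 h2
  rw [Real.dist_eq, sub_zero, abs_of_nonneg (by positivity)]
  refine lt_of_le_of_lt ?_ hK
  rw [div_pow, one_pow, div_le_div_iff₀ (by positivity) (by positivity), one_mul]
  refine le_trans ?_ h
  gcongr
  norm_num

/-- Between jumps the excess falls by κ - 1 per step, so the bound just after the jump serves the
whole block. There the earlier jumps have been cancelled by the drift, except for their costs and
slack. -/
theorem excess_jumpDigits_le {t k : ℕ} (h1 : jumpPos (k + 1) < t) (h2 : t ≤ jumpPos (k + 1 + 1)) :
    ∑ i ∈ Finset.range t, (jumpDigits i : ℝ) - kappaOne * t ≤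
      jump (k + 1) + ∑ j ∈ Finset.range (k + 1), (jumpCost j + 1) ∧
    ∑ j ∈ Finset.range (k + 1), (jump j : ℝ) - ∑ j ∈ Finset.range (k + 1), (jumpCost j + 1) ≤
      (kappaOne - 1) * t := by
  have hδ : 0 < kappaOne - 1 := by linarith [one_lt_kappaOne]
  have e1 := lt_jumpPos_succ k
  have e2 : (kappaOne - 1) * (jumpPos (k + 1) + 1) ≤ (kappaOne - 1) * t := by
    have : (jumpPos (k + 1) : ℝ) + 1 ≤ t := by exact_mod_cast h1
    gcongr
  have e3 : ∑ j ∈ Finset.range (k + 1), ((jump j : ℝ) - jumpCost j - 1) =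
      ∑ j ∈ Finset.range (k + 1), (jump j : ℝ) -
        ∑ j ∈ Finset.range (k + 1), (jumpCost j + 1) := by
    rw [← Finset.sum_sub_distrib]
    exact Finset.sum_congr rfl fun j _ => by ring
  refine ⟨?_, by linarith⟩
  rw [sum_jumpDigits h1 h2, Finset.sum_range_succ]
  linarith

/-! ### Asymptotics of the construction and the upper bound -/

theorem sum_mul_log_ge (k : ℕ) : (k : ℝ) ^ 2 / 2 * Real.log k - k ^ 2 ≤
    ∑ j ∈ Finset.range k, (j : ℝ) * Real.log j := by
  induction k with
  | zero => simp
  | succ k ih =>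
    rw [Finset.sum_range_succ]
    rcases Nat.eq_zero_or_pos k with rfl | hk
    · simp
    have hk' : (1 : ℝ) ≤ k := by exact_mod_cast hk
    have h1 : Real.log (k + 1 : ℕ) ≤ Real.log k + 1 / k := by
      have := Real.log_le_sub_one_of_pos (show (0 : ℝ) < (k + 1 : ℕ) / k by positivity)
      rw [Real.log_div (by positivity) (by positivity)] at this
      have e : ((k + 1 : ℕ) : ℝ) / k - 1 = 1 / k := by push_cast; field_simp; ring
      linarith
    have h2 : Real.log k ≤ k := (Real.log_le_sub_one_of_pos (by linarith)).trans (by linarith)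
    have h3 := mul_le_mul_of_nonneg_left h1 (show (0 : ℝ) ≤ ((k : ℝ) + 1) ^ 2 / 2 by positivity)
    have h4 : ((k : ℝ) + 1) ^ 2 / 2 * (1 / k) ≤ (k + 3) / 2 := by
      rw [div_mul_div_comm, div_le_div_iff₀ (by positivity) (by positivity)]
      nlinarith
    push_cast at h3 ⊢
    nlinarith

open Filter in
theorem eventually_jump_bounds : ∀ᶠ k : ℕ in atTop,
    (jump k : ℝ) + ∑ j ∈ Finset.range k, (jumpCost j + 1) ≤
      2 * jumpScale * k * (Real.log k + Real.log (Real.log k) / 2 + 14) ∧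
    jumpScale / 2 * (k ^ 2 * (Real.log k - 3)) ≤
      ∑ j ∈ Finset.range k, (jump j : ℝ) - ∑ j ∈ Finset.range k, (jumpCost j + 1) := by
  have hcast := tendsto_natCast_atTop_atTop (R := ℝ)
  have hlog := Real.tendsto_log_atTop.comp hcast
  have h0 : ∀ᶠ k : ℕ in atTop, Real.log k ≤ 1 / 8 * k := by
    have := (Real.isLittleO_log_id_atTop.comp_tendsto hcast).bound
      (show (0 : ℝ) < 1 / 8 by norm_num)
    filter_upwards [this] with k hk
    simp only [Function.comp, Real.norm_eq_abs, id] at hk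
    rw [abs_of_nonneg (by positivity : (0 : ℝ) ≤ k)] at hk
    exact (le_abs_self _).trans hk
  filter_upwards [h0, hlog.eventually_ge_atTop 1, hcast.eventually_ge_atTop 30] with k h1 h2 h3
  simp only [Function.comp] at h2
  have hs := jumpScale_ge
  have hs' := jumpScale_le
  set ℓ := Real.log k with hℓ
  have hll : 0 ≤ Real.log ℓ := Real.log_nonneg h2
  have hll' : Real.log ℓ ≤ ℓ := (Real.log_le_sub_one_of_pos (by linarith)).trans (by linarith)
  have hkℓ : (30 : ℝ) ≤ k * ℓ := by nlinarith
  have hlogjump : jumpScale * Real.log (1 + jump k) ≤ jumpScale * (ℓ + Real.log ℓ) + 6 := by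
    have e1 : (1 : ℝ) + jump k ≤ 2 ^ 3 * (k * ℓ) := by
      have := jump_le k
      nlinarith
    have e2 := Real.log_le_log (by positivity) e1
    rw [Real.log_mul (by positivity) (by positivity),
      Real.log_mul (by positivity) (by positivity), Real.log_pow] at e2
    have e3 := mul_le_mul_of_nonneg_left e2 (show 0 ≤ jumpScale by linarith)
    push_cast at e3
    have := jumpScale_mul_log_two
    linarith
  have hcost : ∑ j ∈ Finset.range k, (jumpCost j + 1) ≤
      k * (jumpScale * (ℓ + Real.log ℓ) + 7) := by
    have := Finset.sum_le_card_nsmul (Finset.range k) (fun j => jumpCost j + 1)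
      (jumpScale * (ℓ + Real.log ℓ) + 7) fun j hj => by
        have e1 := jumpCost_le_log j
        have e2 : (jump j : ℝ) ≤ jump k := by
          exact_mod_cast jump_mono (Finset.mem_range.1 hj).le
        have e3 : Real.log (1 + jump j) ≤ Real.log (1 + jump k) :=
          Real.log_le_log (by positivity) (by linarith)
        have e4 := mul_le_mul_of_nonneg_left e3 (show 0 ≤ jumpScale by linarith)
        linarith
    rwa [Finset.card_range, nsmul_eq_mul] at this
  constructor
  · have := jump_le k
    nlinarith
  · have e1 : jumpScale * ((k : ℝ) ^ 2 / 2 * ℓ - k ^ 2) ≤ ∑ j ∈ Finset.range k, (jump j : ℝ) := by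
      refine le_trans (mul_le_mul_of_nonneg_left (sum_mul_log_ge k) (by linarith)) ?_
      rw [Finset.mul_sum]
      exact Finset.sum_le_sum fun j _ => jump_ge j
    have e2 : (k : ℝ) * (jumpScale * (ℓ + Real.log ℓ) + 7) ≤ jumpScale / 2 * k ^ 2 := by
      have : jumpScale * (ℓ + Real.log ℓ) + 7 ≤ jumpScale / 2 * k := by nlinarith
      nlinarith
    nlinarith

open Filter in
theorem eventually_le_sqrt_mul_log {A s h : ℝ} (hA : 0 < A) (hs : 0 < s) (hh : 0 < h)
    (hhA : h * Real.sqrt (2 * A) = 2 * s) :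
    ∀ᶠ k : ℕ in atTop, ∀ t : ℝ, A * (k ^ 2 * (Real.log k - 3)) ≤ t →
      2 * s * k * (Real.log k + Real.log (Real.log k) / 2 + 14) ≤
        h * Real.sqrt (t * Real.log t) * (1 + 2 ^ 5 * (Real.log (Real.log t) / Real.log t)) := by
  have hcast := tendsto_natCast_atTop_atTop (R := ℝ)
  have hlog := Real.tendsto_log_atTop.comp hcast
  have hloglog := Real.tendsto_log_atTop.comp hlog
  have h0 : ∀ᶠ k : ℕ in atTop, A * Real.log k ≤ k := by
    have := (Real.isLittleO_log_id_atTop.comp_tendsto hcast).bound (inv_pos.2 hA)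
    filter_upwards [this] with k hk
    simp only [Function.comp, Real.norm_eq_abs, id] at hk
    rw [abs_of_nonneg (by positivity : (0 : ℝ) ≤ k)] at hk
    have := (le_abs_self _).trans hk
    rwa [inv_mul_eq_div, le_div_iff₀' hA] at this
  filter_upwards [h0, hlog.eventually_ge_atTop 9, hlog.eventually_ge_atTop (3 + A⁻¹),
    hloglog.eventually_ge_atTop 2, eventually_ge_atTop 1] with k h1 h2 h3 h4 h5 t ht
  simp only [Function.comp] at h2 h3 h4
  have hk : (0 : ℝ) < k := by exact_mod_cast h5
  set ℓ := Real.log k with hℓ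
  set m := A * ((k : ℝ) ^ 2 * (ℓ - 3)) with hm
  have hAℓ : 1 ≤ A * (ℓ - 3) := by
    have := mul_le_mul_of_nonneg_left (show A⁻¹ ≤ ℓ - 3 by linarith) hA.le
    rwa [mul_inv_cancel₀ hA.ne'] at this
  have hmk : (k : ℝ) ^ 2 ≤ m := by
    rw [hm]
    nlinarith [sq_nonneg (k : ℝ)]
  have hmk' : m ≤ (k : ℝ) ^ 3 := by
    have : A * (ℓ - 3) ≤ k := by nlinarith
    rw [hm]
    nlinarith [sq_nonneg (k : ℝ)]
  have hm0 : 0 < m := lt_of_lt_of_le (by positivity) hmk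
  have hlm : 2 * ℓ ≤ Real.log m := by
    have := Real.log_le_log (by positivity) hmk
    rw [Real.log_pow] at this
    exact_mod_cast this
  have hlm' : Real.log m ≤ 3 * ℓ := by
    have := Real.log_le_log (by positivity) hmk'
    rw [Real.log_pow] at this
    exact_mod_cast this
  have ht0 : 0 < t := lt_of_lt_of_le hm0 ht
  have hlt : Real.log m ≤ Real.log t := Real.log_le_log hm0 ht
  -- The correction term equals √(t / log t) · log log t, so monotonicity of t / log t beyond e
  -- transfers the estimate from m to every t ≥ m.
  have hanti : m / Real.log m ≤ t / Real.log t := by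
    have hme : Real.exp 1 ≤ m := (Real.le_log_iff_exp_le hm0).1 (by linarith)
    have := Real.log_div_self_antitoneOn hme (hme.trans ht) ht
    simp only at this
    rw [← inv_div, ← inv_div (Real.log t)]
    exact inv_anti₀ (div_pos (by linarith) ht0) this
  have hsq1 : Real.sqrt (2 * A) * (k * (ℓ - 3)) ≤ Real.sqrt (t * Real.log t) := by
    refine Real.le_sqrt_of_sq_le ?_
    rw [mul_pow, Real.sq_sqrt (by positivity)]
    calc 2 * A * (k * (ℓ - 3)) ^ 2 = m * (2 * (ℓ - 3)) := by rw [hm]; ring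
      _ ≤ t * Real.log t := mul_le_mul ht (by linarith) (by linarith) ht0.le
  have hsq2 : Real.sqrt (2 * A) * (k / 3) ≤ Real.sqrt (t / Real.log t) := by
    refine Real.le_sqrt_of_sq_le ?_
    rw [mul_pow, Real.sq_sqrt (by positivity)]
    refine le_trans ?_ hanti
    rw [le_div_iff₀ (by linarith)]
    calc 2 * A * (k / 3) ^ 2 * Real.log m ≤ 2 * A * (k / 3) ^ 2 * (3 * ℓ) := by gcongr
      _ = A * k ^ 2 * (2 * ℓ / 3) := by ring
      _ ≤ A * k ^ 2 * (ℓ - 3) := by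
        have : 2 * ℓ / 3 ≤ ℓ - 3 := by linarith
        gcongr
      _ = m := by rw [hm]; ring
  have hllt : Real.log ℓ ≤ Real.log (Real.log t) := Real.log_le_log (by linarith) (by linarith)
  have hsplit : Real.sqrt (t * Real.log t) / Real.log t = Real.sqrt (t / Real.log t) := by
    rw [Real.sqrt_mul ht0.le, Real.sqrt_div ht0.le, mul_div_assoc, Real.sqrt_div_self', mul_one_div]
  have hprod : Real.sqrt (2 * A) * (k / 3) * Real.log ℓ ≤
      Real.sqrt (t / Real.log t) * Real.log (Real.log t) := by
    gcongr
  -- The constant 2^5 suffices here: the deficit (log ℓ)/2 + 17 is at most (32/3) log ℓ because log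
  -- ℓ ≥ 2.
  calc 2 * s * k * (ℓ + Real.log ℓ / 2 + 14)
      ≤ 2 * s * (k * (ℓ - 3) + 2 ^ 5 * (k / 3 * Real.log ℓ)) := by
        rw [mul_assoc]
        refine mul_le_mul_of_nonneg_left ?_ (by positivity)
        nlinarith
    _ = h * (Real.sqrt (2 * A) * (k * (ℓ - 3)) +
          2 ^ 5 * (Real.sqrt (2 * A) * (k / 3) * Real.log ℓ)) := by rw [← hhA]; ring
    _ ≤ h * (Real.sqrt (t * Real.log t) +
          2 ^ 5 * (Real.sqrt (t / Real.log t) * Real.log (Real.log t))) := by gcongr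
    _ = _ := by rw [← hsplit]; ring

theorem upper_coeff_mul_sqrt :
    Real.sqrt (16 * Real.log lambdaOne - 8 * Real.log 2) / Real.log 2 *
      Real.sqrt (2 * (jumpScale / (2 * (kappaOne - 1)))) = 2 * jumpScale := by
  have hl2 := Real.log_pos one_lt_two
  have hδ : 0 < kappaOne - 1 := by linarith [one_lt_kappaOne]
  have hs := jumpScale_ge
  have e : 16 * Real.log lambdaOne - 8 * Real.log 2 = 8 * Real.log 2 * (kappaOne - 1) := by
    linear_combination -8 * kappaOne_mul_log_two
  rw [e, div_mul_eq_mul_div, ← Real.sqrt_mul (by positivity),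
    div_eq_iff hl2.ne', Real.sqrt_eq_iff_mul_self_eq (by positivity) (by positivity)]
  have := jumpScale_mul_log_two
  field_simp
  linear_combination (-4) * this

open Filter in
theorem exists_excess_le : ∃ x : ℝ, Irrational x ∧ x ∈ Set.Ioo (0 : ℝ) 1 ∧
    HasDerivAt minkowskiQuestionMark 0 x ∧
    ∃ T : ℕ, ∀ t : ℕ, T ≤ t →
      partialQuotientSum x t - kappaOne * (t : ℝ) ≤
        Real.sqrt (16 * Real.log lambdaOne - 8 * Real.log 2) / Real.log 2 *
          Real.sqrt ((t : ℝ) * Real.log (t : ℝ)) *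
          (1 + 2 ^ 5 * (Real.log (Real.log (t : ℝ)) / Real.log (t : ℝ))) := by
  obtain ⟨ξ, h⟩ := exists_isCFExpansion one_le_jumpDigits
  refine ⟨ξ 0, h.irrational, ⟨h.pos 0, h.lt_one 0⟩,
    h.hasDerivAt_zero h.irrational tendsto_sq_cfDen_jumpDigits, ?_⟩
  have hl2 := Real.log_pos one_lt_two
  have hδ : 0 < kappaOne - 1 := by linarith [one_lt_kappaOne]
  have hs := jumpScale_ge
  obtain ⟨K, hK⟩ := eventually_atTop.1 (eventually_jump_bounds.and
    (eventually_le_sqrt_mul_log (A := jumpScale / (2 * (kappaOne - 1))) (by positivity)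
      (by linarith) (div_pos (Real.sqrt_pos.2 (by linarith [log_two_lt])) hl2)
      upper_coeff_mul_sqrt))
  refine ⟨jumpPos (K + 1) + 1, fun t ht => ?_⟩
  obtain ⟨k, h1, h2⟩ := exists_block jumpPos_strictMono rfl (t := t) (by omega)
  have hKk : K + 1 < k + 1 := jumpPos_strictMono.lt_iff_lt.1 (by omega)
  obtain ⟨k, rfl⟩ : ∃ k', k = k' + 1 := ⟨k - 1, by omega⟩
  obtain ⟨e1, e2⟩ := excess_jumpDigits_le h1 h2
  obtain ⟨⟨f1, f2⟩, f3⟩ := hK (k + 1) (by omega)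
  rw [h.partialQuotientSum_eq]
  refine e1.trans (f1.trans (f3 t ?_))
  rw [div_mul_eq_mul_div, div_le_iff₀ (by positivity)]
  linarith

theorem theorem2 :
    (∀ x : ℝ, Irrational x → x ∈ Set.Ioo (0 : ℝ) 1 →
      HasDerivAt minkowskiQuestionMark 0 x →
      ∀ ψ : ℕ → ℝ, (∀ t, 0 ≤ ψ t) →
        Asymptotics.IsLittleO Filter.atTop ψ
          (fun t : ℕ => Real.log (Real.log (t : ℝ)) / Real.log (t : ℝ)) →
        ∃ T : ℕ, ∀ t : ℕ, T ≤ t →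
          ∃ M : ℝ,
            IsGreatest ((fun u : ℕ => partialQuotientSum x u - kappaOne * (u : ℝ)) ''
              Set.Icc 1 t) M ∧
            Real.sqrt (2 * Real.log lambdaOne - Real.log 2) / Real.log 2 *
                Real.sqrt ((t : ℝ) * Real.log (t : ℝ)) * (1 - (t : ℝ) ^ (-ψ t)) ≤ M) ∧
    (∃ x : ℝ, Irrational x ∧ x ∈ Set.Ioo (0 : ℝ) 1 ∧
      HasDerivAt minkowskiQuestionMark 0 x ∧
      ∃ T : ℕ, ∀ t : ℕ, T ≤ t →
        partialQuotientSum x t - kappaOne * (t : ℝ) ≤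
          Real.sqrt (16 * Real.log lambdaOne - 8 * Real.log 2) / Real.log 2 *
            Real.sqrt ((t : ℝ) * Real.log (t : ℝ)) *
            (1 + 2 ^ 5 * (Real.log (Real.log (t : ℝ)) / Real.log (t : ℝ)))) := by
  exact ⟨fun x hx h01 hd ψ _ hψ => excess_lower_bound hx h01 hd hψ, exists_excess_le⟩
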